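/- Let $n\ge 2$ and let $U\subset\mathbb R^n$ be a bounded open set with $C^2$ boundary $\partial U=\Gamma_i\cup\Gamma_e$, where $\Gamma_i\neq\emptyset$ and $\Gamma_e$ are disjoint closed sets; let $N$ be the outward unit normal and $ds$ the surface measure. Let $\alpha,A,T_0>0$. In the Darcy case (Forchheimer coefficient $F=0$), the flow of an ideal gas with density $\rho=p$ has velocity $u=-\frac1\alpha\nabla p$. For a pressure distribution $f$ on $\overline U$, the gas productivity index is $$J[f]=\frac{-\int_{\Gamma_i}\frac1\alpha f\,\nabla f\cdot N\,ds}{\frac1{|U|}\int_U f^2\,dx-\frac1{|\Gamma_i|}\int_{\Gamma_i}f^2\,ds}.$$ Let $W\in C^2(U)\cap C^1(\overline U)$ be a solution of $-\nabla\cdot(\frac1\alpha\nabla W)=A$ in $U$, $W=0$ on $\Gamma_i$, $\nabla W\cdot N=0$ on $\Gamma_e$. For $B>0$ put $T_{crit}=B/A$ and $p_0(x,t)=\sqrt{(B-At)^2+2W(x)}$. (a) If $T_0<T_{crit}$, then for every $t\in[0,T_0]$ $$J[p_0(\cdot,t)]=\frac{Q_0}{\frac1{|U|}\int_U 2W\,dx},\qquad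 Q_0=-\int_{\Gamma_i}\tfrac1\alpha\nabla W\cdot N\,ds;$$ thus this index, denoted $J[p_0]$, depends neither on $t$ nor on $B$. (b) For every constant $C$ and every $\varepsilon>0$ there is $B_0$ such that the following holds for every $B\ge B_0$ with $T_0<T_{crit}=B/A$. Let $p$ be a positive classical solution on $\overline U\times[0,T_0]$ of $$\frac{\partial p}{\partial t}=\nabla\cdot\Big(\frac1\alpha\,p\nabla p\Big)\ \text{in } U\times(0,T_0],\qquad p=B-At\ \text{on }\Gamma_i,\qquad p\,\nabla p\cdot N=0\ \text{on }\Gamma_e,\qquad p(x,0)=p_0(x,0)$$ (that is, $p$ is continuous on $\overline U\times[0,T_0]$, $C^1$ in $t$ and $C^2$ in $x$ in $U\times(0,T_0]$, and $\nabla p$ is continuous on $\overline U\times(0,T_0]$), and suppose that in $U\times(0,T_0]$ $$|\nabla p|+\Delta p\le C,\qquad |p_t|\le C .$$ Then $|J[p(\cdot,t)]-J[p_0]|<\varepsilon$ for all $t\in[0,T_0]$. In other words, under derivative bounds independent of $B$, $J[p](t)-J[p_0]\to0$ as $B\to\infty$, uniformly for $t\in[0,T_0]$. -/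

import Mathlib

open Set Filter Topology MeasureTheory

noncomputable section

/-- `φ` is a local `C²` defining function of the open set `U` near the boundary point `x`. -/
def IsLocalDefiningFunction {n : ℕ} (U : Set (EuclideanSpace ℝ (Fin n)))
    (x : EuclideanSpace ℝ (Fin n)) (φ : EuclideanSpace ℝ (Fin n) → ℝ) : Prop :=
  ∃ V ∈ 𝓝 x, ContDiffOn ℝ 2 φ V ∧ φ x = 0 ∧ gradient φ x ≠ 0 ∧ ∀ y ∈ V, (y ∈ U ↔ φ y < 0)

/-- The boundary of `U` is of class `C²`, with `U` locally on one side of it. -/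
def HasC2Boundary {n : ℕ} (U : Set (EuclideanSpace ℝ (Fin n))) : Prop :=
  ∀ x ∈ frontier U, ∃ φ, IsLocalDefiningFunction U x φ

open Classical in
/-- The outward unit normal `N(x)` at a boundary point: the normalized gradient of a local
defining function (it does not depend on which one is chosen). -/
def outwardNormal {n : ℕ} (U : Set (EuclideanSpace ℝ (Fin n)))
    (x : EuclideanSpace ℝ (Fin n)) : EuclideanSpace ℝ (Fin n) :=
  if h : ∃ φ, IsLocalDefiningFunction U x φ then
    ‖gradient h.choose x‖⁻¹ • gradient h.choose x
  else 0

/-- The standing assumptions on the reservoir: `U` is bounded and open in `ℝⁿ` with `C²` boundary,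
which is the union of the disjoint closed sets `Γi` (the well, non-empty) and `Γe` (the
exterior boundary). -/
structure IsReservoir {n : ℕ} (U Γi Γe : Set (EuclideanSpace ℝ (Fin n))) : Prop where
  isOpen : IsOpen U
  bounded : Bornology.IsBounded U
  boundary_C2 : HasC2Boundary U
  boundary_eq : frontier U = Γi ∪ Γe
  disjoint : Disjoint Γi Γe
  closed_well : IsClosed Γi
  closed_ext : IsClosed Γe
  well_nonempty : Γi.Nonempty

/-- The gradient on `closure U`: the usual gradient in `U`, and the one-sided gradient (along the
closure of the domain) at boundary points. -/
def grad {n : ℕ} (U : Set (EuclideanSpace ℝ (Fin n)))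
    (f : EuclideanSpace ℝ (Fin n) → ℝ) (x : EuclideanSpace ℝ (Fin n)) :
    EuclideanSpace ℝ (Fin n) :=
  gradientWithin f (closure U) x

/-- The divergence `∑ᵢ ∂Fᵢ/∂xᵢ` of a vector field. -/
def divergence {n : ℕ} (F : EuclideanSpace ℝ (Fin n) → EuclideanSpace ℝ (Fin n))
    (x : EuclideanSpace ℝ (Fin n)) : ℝ :=
  ∑ i : Fin n, fderiv ℝ F x (EuclideanSpace.single i 1) i

/-- The permeability function `K₂(ξ) = 2 / (α + √(α² + 4βξ))` of the two-term Forchheimer law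
`α u + β ρ u |u| = -∇p`. The Darcy case (vanishing Forchheimer coefficient) is `β = 0`. -/
def K₂ (α β ξ : ℝ) : ℝ := 2 / (α + √(α ^ 2 + 4 * β * ξ))

/-- The velocity `u = -K₂(p|∇p|) ∇p` of the ideal gas (`ρ = p`). -/
def velocity {n : ℕ} (α β : ℝ) (U : Set (EuclideanSpace ℝ (Fin n)))
    (f : EuclideanSpace ℝ (Fin n) → ℝ) (x : EuclideanSpace ℝ (Fin n)) :
    EuclideanSpace ℝ (Fin n) :=
  -(K₂ α β (f x * ‖grad U f x‖) • grad U f x)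

/-- The operator `L[p] = ∇·(K₂(p|∇p|) p ∇p)`. -/
def gasOperator {n : ℕ} (α β : ℝ) (U : Set (EuclideanSpace ℝ (Fin n)))
    (f : EuclideanSpace ℝ (Fin n) → ℝ) (x : EuclideanSpace ℝ (Fin n)) : ℝ :=
  divergence (fun y => (K₂ α β (f y * ‖grad U f y‖) * f y) • grad U f y) x

/-- The surface measure on hypersurfaces of `ℝⁿ`. -/
def surfaceMeasure (n : ℕ) : Measure (EuclideanSpace ℝ (Fin n)) :=
  Measure.euclideanHausdorffMeasure (n - 1)

/-- The total mass flow `∫_{Γi} ρ u·N ds` through the well, with `ρ = p`. -/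
def massFlow {n : ℕ} (α β : ℝ) (U Γi : Set (EuclideanSpace ℝ (Fin n)))
    (f : EuclideanSpace ℝ (Fin n) → ℝ) : ℝ :=
  ∫ x in Γi, inner ℝ (f x • velocity α β U f x) (outwardNormal U x) ∂(surfaceMeasure n)

/-- The drawdown `|U|⁻¹ ∫_U p² dx - |Γi|⁻¹ ∫_{Γi} p² ds`. -/
def drawdown {n : ℕ} (U Γi : Set (EuclideanSpace ℝ (Fin n)))
    (f : EuclideanSpace ℝ (Fin n) → ℝ) : ℝ :=
  (⨍ x in U, f x ^ 2) - ⨍ x in Γi, f x ^ 2 ∂(surfaceMeasure n)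

/-- The gas productivity index `J` of a pressure distribution (at a given instant). -/
def productivityIndex {n : ℕ} (α β : ℝ) (U Γi : Set (EuclideanSpace ℝ (Fin n)))
    (f : EuclideanSpace ℝ (Fin n) → ℝ) : ℝ :=
  massFlow α β U Γi f / drawdown U Γi f

/-- `W` is a classical solution of `-∇·(K₂(|∇W|)∇W) = A` in `U`, `W = 0` on `Γi`,
`∇W·N = 0` on `Γe`. -/
structure IsBasicProfile {n : ℕ} (α β A : ℝ) (U Γi Γe : Set (EuclideanSpace ℝ (Fin n)))
    (W : EuclideanSpace ℝ (Fin n) → ℝ) : Prop where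
  contDiffOn : ContDiffOn ℝ 2 W U
  differentiableOn : DifferentiableOn ℝ W (closure U)
  continuousOn_grad : ContinuousOn (grad U W) (closure U)
  equation : ∀ x ∈ U, -divergence (fun y => K₂ α β ‖grad U W y‖ • grad U W y) x = A
  dirichlet : ∀ x ∈ Γi, W x = 0
  neumann : ∀ x ∈ Γe, inner ℝ (grad U W x) (outwardNormal U x) = 0

/-- The auxiliary pressure `p₀(x,t) = √((B - A t)² + 2 W(x))`. -/
def auxPressure {n : ℕ} (A B : ℝ) (W : EuclideanSpace ℝ (Fin n) → ℝ) (t : ℝ)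
    (x : EuclideanSpace ℝ (Fin n)) : ℝ :=
  √((B - A * t) ^ 2 + 2 * W x)

/-- The time derivative `∂p/∂t` on `[0,T]` (one-sided at the ends of the interval). -/
def timeDeriv {n : ℕ} (T : ℝ) (p : ℝ → EuclideanSpace ℝ (Fin n) → ℝ) (t : ℝ)
    (x : EuclideanSpace ℝ (Fin n)) : ℝ :=
  derivWithin (fun s => p s x) (Icc 0 T) t

/-- `p` is a positive classical solution on `[0,T]` of `∂p/∂t = L[p]` with `p = B - A t` on `Γi`,
no mass flux through `Γe`, and the initial value `p(x,0) = init x`. -/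
structure IsGasSolution {n : ℕ} (α β A B T : ℝ) (U Γi Γe : Set (EuclideanSpace ℝ (Fin n)))
    (init : EuclideanSpace ℝ (Fin n) → ℝ) (p : ℝ → EuclideanSpace ℝ (Fin n) → ℝ) : Prop where
  continuousOn : ContinuousOn (fun z : ℝ × EuclideanSpace ℝ (Fin n) => p z.1 z.2)
    (Icc 0 T ×ˢ closure U)
  positive : ∀ t ∈ Icc 0 T, ∀ x ∈ closure U, 0 < p t x
  time_differentiable : ∀ t ∈ Ioc 0 T, ∀ x ∈ U,
    DifferentiableWithinAt ℝ (fun s => p s x) (Icc 0 T) t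
  continuousOn_timeDeriv : ContinuousOn
    (fun z : ℝ × EuclideanSpace ℝ (Fin n) => timeDeriv T p z.1 z.2) (Ioc 0 T ×ˢ U)
  contDiffOn : ∀ t ∈ Ioc 0 T, ContDiffOn ℝ 2 (p t) U
  continuousOn_hessian : ContinuousOn
    (fun z : ℝ × EuclideanSpace ℝ (Fin n) => iteratedFDeriv ℝ 2 (p z.1) z.2) (Ioc 0 T ×ˢ U)
  differentiableOn : ∀ t ∈ Ioc 0 T, DifferentiableOn ℝ (p t) (closure U)
  continuousOn_grad : ContinuousOn
    (fun z : ℝ × EuclideanSpace ℝ (Fin n) => grad U (p z.1) z.2) (Ioc 0 T ×ˢ closure U)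
  equation : ∀ t ∈ Ioc 0 T, ∀ x ∈ U, timeDeriv T p t x = gasOperator α β U (p t) x
  dirichlet : ∀ t ∈ Icc 0 T, ∀ x ∈ Γi, p t x = B - A * t
  neumann : ∀ t ∈ Ioc 0 T, ∀ x ∈ Γe,
    inner ℝ (p t x • velocity α β U (p t) x) (outwardNormal U x) = 0
  initial : ∀ x ∈ closure U, p 0 x = init x

/-- The derivative bounds `|∇p| + Δp ≤ C` and `|∂p/∂t| ≤ C`. -/
def DerivativeBounds {n : ℕ} (T C : ℝ) (U : Set (EuclideanSpace ℝ (Fin n)))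
    (p : ℝ → EuclideanSpace ℝ (Fin n) → ℝ) : Prop :=
  ∀ t ∈ Ioc 0 T, ∀ x ∈ U,
    ‖grad U (p t) x‖ + Laplacian.laplacian (p t) x ≤ C ∧ |timeDeriv T p t x| ≤ C

/-- The critical time `T_crit = B / A`. -/
def criticalTime (A B : ℝ) : ℝ := B / A

/-- The time-independent productivity index `Q₀ / (|U|⁻¹ ∫_U 2W dx)` of the auxiliary pressure,
with the total flux `Q₀ = ∫_{Γi} -K₂(|∇W|)∇W·N ds`. -/
def auxIndex {n : ℕ} (α β : ℝ) (U Γi : Set (EuclideanSpace ℝ (Fin n)))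
    (W : EuclideanSpace ℝ (Fin n) → ℝ) : ℝ :=
  (∫ x in Γi, inner ℝ (-(K₂ α β ‖grad U W x‖ • grad U W x)) (outwardNormal U x)
      ∂(surfaceMeasure n)) / ⨍ x in U, 2 * W x

end

/-! ### Local geometry of a `C²` boundary -/

/-! In the Darcy case `p∇p = ½∇(p²)`, so everything is expressed through `v = p² - (B - At)²`, which
vanishes on `Γi`; for the auxiliary pressure it equals `2W`. The heart is a sandwich `θ·2W ≤ v ≤ 2W`
on the closed domain with `θ = 1 - k/2` and `k = (2M+1)/(B - AT)²`, where `M` bounds `W`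
(`IsGasSolution.sq_bounds`). Both inequalities come from a maximum principle for the nondivergence
form `w_t = (p/α)Δw + …` (`parabolic_comparison`, `IsGasSolution.comparison`).

Integrated over `U`, the sandwich bounds the drawdown between `θ` and `1` times that of `2W`. On
`Γi` its three members all vanish, so their normal derivatives are ordered too, and the mass flow
lies between `θQ₀` and `Q₀`. No integration by parts is needed. The quotient then differs from
`J[p₀]` by at most `J[p₀]·k` (`abs_div_sub_div_le`), and `k → 0` as `B → ∞`, uniformly in `t`. Part
(a) is the same sandwich with `θ = 1`.

The boundary geometry serves two purposes: the interior sphere condition drives a Hopf-type argument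
on `Γe`, and the local graph structure shows that `Γi` has finite positive surface measure. -/

theorem IsLocalDefiningFunction.contDiffAt {n : ℕ} {U : Set (EuclideanSpace ℝ (Fin n))}
    {x : EuclideanSpace ℝ (Fin n)} {φ : EuclideanSpace ℝ (Fin n) → ℝ}
    (h : IsLocalDefiningFunction U x φ) : ContDiffAt ℝ 2 φ x := by
  obtain ⟨V, hV, hc, -⟩ := h
  exact hc.contDiffAt hV

/-- The derivative is Lipschitz near `x`, so on the ball of radius `‖v‖` it deviates from its value
at `x` by at most `K‖v‖`; the mean value inequality on that ball gives the claim. -/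
theorem ContDiffAt.exists_quadratic_bound {E : Type*} [NormedAddCommGroup E] [NormedSpace ℝ E]
    {φ : E → ℝ} {x : E} (h : ContDiffAt ℝ 2 φ x) :
    ∃ K > 0, ∃ r > 0, ∀ v, ‖v‖ < r → |φ (x + v) - φ x - fderiv ℝ φ x v| ≤ K * ‖v‖ ^ 2 := by
  have h1 : ContDiffAt ℝ 1 (fderiv ℝ φ) x := h.fderiv_right (by norm_num)
  obtain ⟨K, t, ht, hL⟩ := h1.exists_lipschitzOnWith
  have hd : ∀ᶠ y in 𝓝 x, DifferentiableAt ℝ φ y := by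
    filter_upwards [h.eventually (by simp)] with y hy
    exact hy.differentiableAt (by norm_num)
  obtain ⟨r, hr, hball⟩ := Metric.mem_nhds_iff.1 (inter_mem ht hd)
  refine ⟨K + 1, by positivity, r, hr, fun v hv => ?_⟩
  have hsub : Metric.closedBall x ‖v‖ ⊆ Metric.ball x r := Metric.closedBall_subset_ball hv
  have key := (convex_closedBall x ‖v‖).norm_image_sub_le_of_norm_hasFDerivWithin_le'
    (f := φ) (f' := fun y => fderiv ℝ φ y) (φ := fderiv ℝ φ x) (C := K * ‖v‖)
    (x := x) (y := x + v)
    (fun y hy => ((hball (hsub hy)).2 : DifferentiableAt ℝ φ y).hasFDerivAt.hasFDerivWithinAt)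
    (fun y hy => by
      have := hL.dist_le_mul y (hball (hsub hy)).1 x (mem_of_mem_nhds ht)
      rw [dist_eq_norm] at this
      exact this.trans (by gcongr; exact Metric.mem_closedBall.1 hy))
    (by simp) (by simp)
  simp only [add_sub_cancel_left, Real.norm_eq_abs] at key
  nlinarith [sq_nonneg ‖v‖]

theorem IsLocalDefiningFunction.exists_quadratic_bound {n : ℕ}
    {U : Set (EuclideanSpace ℝ (Fin n))} {x : EuclideanSpace ℝ (Fin n)}
    {φ : EuclideanSpace ℝ (Fin n) → ℝ} (h : IsLocalDefiningFunction U x φ) :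
    ∃ K > 0, ∃ r > 0, ∀ v, ‖v‖ < r →
      |φ (x + v) - inner ℝ (gradient φ x) v| ≤ K * ‖v‖ ^ 2 ∧ (x + v ∈ U ↔ φ (x + v) < 0) := by
  obtain ⟨K, hK, r, hr, hb⟩ := h.contDiffAt.exists_quadratic_bound
  obtain ⟨V, hV, -, h0, -, hU⟩ := h
  obtain ⟨s, hs, hsV⟩ := Metric.mem_nhds_iff.1 hV
  refine ⟨K, hK, min r s, lt_min hr hs, fun v hv => ⟨?_, ?_⟩⟩
  · have := hb v (hv.trans_le (min_le_left _ _))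
    rwa [h0, sub_zero, ← inner_gradient_left] at this
  · exact hU _ (hsV (by simpa using hv.trans_le (min_le_right _ _)))

/-- Interior sphere condition, with centers along the normalized gradient. -/
theorem IsLocalDefiningFunction.exists_ball_subset {n : ℕ}
    {U : Set (EuclideanSpace ℝ (Fin n))} {x : EuclideanSpace ℝ (Fin n)}
    {φ : EuclideanSpace ℝ (Fin n) → ℝ} (h : IsLocalDefiningFunction U x φ) :
    ∃ R₀ > 0, ∀ R ∈ Ioc 0 R₀,
      Metric.ball (x - R • (‖gradient φ x‖⁻¹ • gradient φ x)) R ⊆ U := by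
  obtain ⟨K, hK, r, hr, hb⟩ := h.exists_quadratic_bound
  have hg : gradient φ x ≠ 0 := by
    obtain ⟨V, -, -, -, h1, -⟩ := h
    exact h1
  set g := gradient φ x with hgdef
  have hgn : 0 < ‖g‖ := norm_pos_iff.2 hg
  -- The first bound keeps the tangent ball, of diameter `2R`, inside the range of the quadratic
  -- estimate; the second makes the linear term dominate, since in that ball `K‖v‖² < -2RK⟪N, v⟫`.
  refine ⟨min (r / 2) (‖g‖ / (2 * K)), by positivity, fun R hR y hy => ?_⟩
  have hR1 : R ≤ r / 2 := hR.2.trans (min_le_left _ _)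
  have hR2 : R * (2 * K) ≤ ‖g‖ := (le_div_iff₀ (by positivity)).1 (hR.2.trans (min_le_right _ _))
  set N := ‖g‖⁻¹ • g with hN
  have hNn : ‖N‖ = 1 := by
    rw [hN, norm_smul, norm_inv, norm_norm, inv_mul_cancel₀ hgn.ne']
  have hgN : g = ‖g‖ • N := by rw [hN, smul_smul, mul_inv_cancel₀ hgn.ne', one_smul]
  set v := y - x with hv
  have hy' : ‖v + R • N‖ < R := by
    have : v + R • N = y - (x - R • N) := by rw [hv]; abel
    rw [this, ← dist_eq_norm]; exact hy
  have hvr : ‖v‖ < r := by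
    have : ‖v‖ ≤ ‖v + R • N‖ + ‖R • N‖ := norm_le_add_norm_add v (R • N) |>.trans (by linarith)
    rw [norm_smul, hNn, Real.norm_of_nonneg hR.1.le] at this
    linarith
  have hsq : ‖v‖ ^ 2 + 2 * R * inner ℝ N v < 0 := by
    have h1 : ‖v + R • N‖ ^ 2 < R ^ 2 := by
      have := norm_nonneg (v + R • N)
      nlinarith
    rw [norm_add_sq_real, norm_smul, hNn, Real.norm_of_nonneg hR.1.le, inner_smul_right,
      real_inner_comm] at h1
    linarith
  obtain ⟨h1, h2⟩ := hb v hvr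
  have hxy : x + v = y := by rw [hv]; abel
  rw [hxy] at h1 h2
  rw [h2]
  have h3 : inner ℝ g v = ‖g‖ * inner ℝ N v := by
    conv_lhs => rw [hgN]
    rw [real_inner_smul_left]
  rw [h3] at h1
  have h4 := (abs_le.1 h1).2
  have hin : inner ℝ N v < 0 := by
    by_contra hcon
    have : 0 ≤ 2 * R * inner ℝ N v := mul_nonneg (by linarith [hR.1]) (not_lt.1 hcon)
    nlinarith [sq_nonneg ‖v‖]
  have h5 : K * ‖v‖ ^ 2 < K * (-(2 * R * inner ℝ N v)) := by
    apply mul_lt_mul_of_pos_left _ hK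
    linarith
  nlinarith

/-- Two local defining functions at a point have the same normalized gradient. -/
theorem IsLocalDefiningFunction.normal_unique {n : ℕ}
    {U : Set (EuclideanSpace ℝ (Fin n))} {x : EuclideanSpace ℝ (Fin n)}
    {φ ψ : EuclideanSpace ℝ (Fin n) → ℝ} (h : IsLocalDefiningFunction U x φ)
    (h' : IsLocalDefiningFunction U x ψ) :
    ‖gradient φ x‖⁻¹ • gradient φ x = ‖gradient ψ x‖⁻¹ • gradient ψ x := by
  obtain ⟨R, hR, hball⟩ := h.exists_ball_subset
  specialize hball R ⟨hR, le_rfl⟩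
  obtain ⟨K, hK, r, hr, hb⟩ := h'.exists_quadratic_bound
  have hg : gradient φ x ≠ 0 := by
    obtain ⟨V, -, -, -, h1, -⟩ := h
    exact h1
  have hg' : gradient ψ x ≠ 0 := by
    obtain ⟨V, -, -, -, h1, -⟩ := h'
    exact h1
  set a := ‖gradient φ x‖⁻¹ • gradient φ x with ha
  set b := ‖gradient ψ x‖⁻¹ • gradient ψ x with hbdef
  have han : ‖a‖ = 1 := by
    rw [ha, norm_smul, norm_inv, norm_norm, inv_mul_cancel₀ (norm_ne_zero_iff.2 hg)]
  have hbn : ‖b‖ = 1 := by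
    rw [hbdef, norm_smul, norm_inv, norm_norm, inv_mul_cancel₀ (norm_ne_zero_iff.2 hg')]
  by_contra hne
  have hc : inner ℝ a b < 1 := by
    rcases (real_inner_le_norm a b).lt_or_eq with h1 | h1
    · simpa [han, hbn] using h1
    · rw [han, hbn, mul_one] at h1
      exact absurd ((inner_eq_one_iff_of_norm_eq_one han hbn).1 h1) hne
  -- If the unit vectors `a` and `b` differed, `b - a` would point strictly into the interior ball
  -- of `φ`, yet strictly towards increasing `ψ`; a short step along it would be both in `U` and
  -- outside it.
  set v := b - a with hv
  have hav : inner ℝ a v < 0 := by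
    rw [hv, inner_sub_right, real_inner_self_eq_norm_sq, han]; linarith
  have hbv : 0 < inner ℝ b v := by
    rw [hv, inner_sub_right, real_inner_self_eq_norm_sq, hbn, real_inner_comm]; linarith
  have hgb : gradient ψ x = ‖gradient ψ x‖ • b := by
    rw [hbdef, smul_smul, mul_inv_cancel₀ (norm_ne_zero_iff.2 hg'), one_smul]
  have hgv : 0 < inner ℝ (gradient ψ x) v := by
    rw [hgb, real_inner_smul_left]
    exact mul_pos (norm_pos_iff.2 hg') hbv
  have hev : ∀ᶠ t : ℝ in 𝓝[>] 0, ‖t • v‖ < r ∧ t * ‖v‖ ^ 2 + 2 * R * inner ℝ a v < 0 ∧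
      t * (K * ‖v‖ ^ 2) < inner ℝ (gradient ψ x) v := by
    refine nhdsWithin_le_nhds ?_
    have c1 : Tendsto (fun t : ℝ => ‖t • v‖) (𝓝 0) (𝓝 0) := by
      have : Continuous fun t : ℝ => ‖t • v‖ := by fun_prop
      simpa using this.tendsto 0
    have c2 : Tendsto (fun t : ℝ => t * ‖v‖ ^ 2 + 2 * R * inner ℝ a v) (𝓝 0)
        (𝓝 (2 * R * inner ℝ a v)) := by
      have : Continuous fun t : ℝ => t * ‖v‖ ^ 2 + 2 * R * inner ℝ a v := by fun_prop
      simpa using this.tendsto 0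
    have c3 : Tendsto (fun t : ℝ => t * (K * ‖v‖ ^ 2)) (𝓝 0) (𝓝 0) := by
      have : Continuous fun t : ℝ => t * (K * ‖v‖ ^ 2) := by fun_prop
      simpa using this.tendsto 0
    exact (c1.eventually_lt_const hr).and ((c2.eventually_lt_const (by nlinarith)).and
      (c3.eventually_lt_const hgv))
  obtain ⟨t, ⟨h1, h2, h3⟩, ht⟩ := (hev.and self_mem_nhdsWithin).exists
  have ht : 0 < t := ht
  have hmem : x + t • v ∈ U := by
    apply hball
    rw [Metric.mem_ball, dist_eq_norm]
    have e : x + t • v - (x - R • a) = t • v + R • a := by abel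
    rw [e]
    refine lt_of_pow_lt_pow_left₀ 2 hR.le ?_
    rw [norm_add_sq_real, norm_smul, norm_smul, han, Real.norm_of_nonneg ht.le,
      Real.norm_of_nonneg hR.le, real_inner_smul_left, inner_smul_right, real_inner_comm]
    nlinarith
  obtain ⟨h4, h5⟩ := hb (t • v) h1
  rw [h5] at hmem
  have h6 := (abs_le.1 h4).1
  rw [inner_smul_right, norm_smul, Real.norm_of_nonneg ht.le] at h6
  nlinarith

theorem IsLocalDefiningFunction.outwardNormal_eq {n : ℕ}
    {U : Set (EuclideanSpace ℝ (Fin n))} {x : EuclideanSpace ℝ (Fin n)}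
    {φ : EuclideanSpace ℝ (Fin n) → ℝ} (h : IsLocalDefiningFunction U x φ) :
    outwardNormal U x = ‖gradient φ x‖⁻¹ • gradient φ x := by
  have hex : ∃ φ, IsLocalDefiningFunction U x φ := ⟨φ, h⟩
  rw [outwardNormal, dif_pos hex]
  exact hex.choose_spec.normal_unique h

theorem IsLocalDefiningFunction.norm_outwardNormal {n : ℕ}
    {U : Set (EuclideanSpace ℝ (Fin n))} {x : EuclideanSpace ℝ (Fin n)}
    {φ : EuclideanSpace ℝ (Fin n) → ℝ} (h : IsLocalDefiningFunction U x φ) :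
    ‖outwardNormal U x‖ = 1 := by
  have hg : gradient φ x ≠ 0 := by
    obtain ⟨V, -, -, -, h1, -⟩ := h
    exact h1
  rw [h.outwardNormal_eq, norm_smul, norm_inv, norm_norm, inv_mul_cancel₀ (norm_ne_zero_iff.2 hg)]

theorem HasC2Boundary.norm_outwardNormal {n : ℕ} {U : Set (EuclideanSpace ℝ (Fin n))}
    (h : HasC2Boundary U) {x : EuclideanSpace ℝ (Fin n)} (hx : x ∈ frontier U) :
    ‖outwardNormal U x‖ = 1 := by
  obtain ⟨φ, hφ⟩ := h x hx
  exact hφ.norm_outwardNormal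

theorem HasC2Boundary.exists_ball_subset {n : ℕ} {U : Set (EuclideanSpace ℝ (Fin n))}
    (h : HasC2Boundary U) {x : EuclideanSpace ℝ (Fin n)} (hx : x ∈ frontier U) :
    ∃ R₀ > 0, ∀ R ∈ Ioc 0 R₀, Metric.ball (x - R • outwardNormal U x) R ⊆ U := by
  obtain ⟨φ, hφ⟩ := h x hx
  rw [hφ.outwardNormal_eq]
  exact hφ.exists_ball_subset

theorem HasC2Boundary.exists_sub_smul_mem {n : ℕ} {U : Set (EuclideanSpace ℝ (Fin n))}
    (h : HasC2Boundary U) {x : EuclideanSpace ℝ (Fin n)} (hx : x ∈ frontier U) :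
    ∃ s₀ : ℝ, 0 < s₀ ∧ ∀ s ∈ Ioc 0 s₀, x - s • outwardNormal U x ∈ U := by
  obtain ⟨R, hR, hb⟩ := h.exists_ball_subset hx
  exact ⟨R, hR, fun s hs => hb s hs (Metric.mem_ball_self hs.1)⟩

/-- At a nearby frontier point, `φ ≤ 0` as a limit from `U` and `φ ≥ 0` because the point is not in
the open set `U`. One function thus describes the normal at all nearby boundary points, which gives
its continuity. -/
theorem IsLocalDefiningFunction.eventually_frontier {n : ℕ}
    {U : Set (EuclideanSpace ℝ (Fin n))} (hU : IsOpen U) {x : EuclideanSpace ℝ (Fin n)}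
    {φ : EuclideanSpace ℝ (Fin n) → ℝ} (h : IsLocalDefiningFunction U x φ) :
    ∀ᶠ y in 𝓝[frontier U] x, IsLocalDefiningFunction U y φ := by
  have hcd := h.contDiffAt
  obtain ⟨V, hV, hc, h0, hg, hUV⟩ := h
  have hgc : ContinuousAt (gradient φ) x :=
    (InnerProductSpace.toDual ℝ _).symm.continuous.continuousAt.comp
      (hcd.continuousAt_fderiv (by norm_num))
  have hg' : ∀ᶠ y in 𝓝[frontier U] x, gradient φ y ≠ 0 :=
    nhdsWithin_le_nhds (hgc.eventually_ne hg)
  filter_upwards [hg', nhdsWithin_le_nhds (eventually_mem_nhds_iff.2 hV), self_mem_nhdsWithin]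
    with y hgy hVy hy
  refine ⟨V, hVy, hc, ?_, hgy, hUV⟩
  rw [hU.frontier_eq] at hy
  refine le_antisymm ?_ ?_
  · have hcont : ContinuousAt φ y := (hc.contDiffAt hVy).continuousAt
    have hcl : ∃ᶠ z in 𝓝 y, z ∈ U := mem_closure_iff_frequently.1 hy.1
    by_contra hlt
    obtain ⟨z, hz, hpos, hzV⟩ := (hcl.and_eventually
      ((hcont.eventually_const_lt (not_le.1 hlt)).and hVy)).exists
    exact hpos.not_gt ((hUV z hzV).1 hz)
  · by_contra hlt
    exact hy.2 ((hUV y (mem_of_mem_nhds hVy)).2 (not_le.1 hlt))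

theorem HasC2Boundary.continuousOn_outwardNormal {n : ℕ} {U : Set (EuclideanSpace ℝ (Fin n))}
    (hU : IsOpen U) (h : HasC2Boundary U) : ContinuousOn (outwardNormal U) (frontier U) := by
  intro x hx
  obtain ⟨φ, hφ⟩ := h x hx
  have hgc : ContinuousAt (gradient φ) x :=
    (InnerProductSpace.toDual ℝ _).symm.continuous.continuousAt.comp
      (hφ.contDiffAt.continuousAt_fderiv (by norm_num))
  have hg : gradient φ x ≠ 0 := by
    obtain ⟨V, -, -, -, h1, -⟩ := hφ
    exact h1
  have hcw : ContinuousWithinAt (fun y => ‖gradient φ y‖⁻¹ • gradient φ y) (frontier U) x :=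
    ((hgc.norm.inv₀ (norm_ne_zero_iff.2 hg)).smul hgc).continuousWithinAt
  refine hcw.congr_of_eventuallyEq ?_ hφ.outwardNormal_eq
  filter_upwards [hφ.eventually_frontier hU] with y hy using hy.outwardNormal_eq

/-- The normal component of a one-sided gradient is a one-sided derivative along the inward
normal. -/
theorem HasC2Boundary.hasDerivWithinAt_normal {n : ℕ} {U : Set (EuclideanSpace ℝ (Fin n))}
    (h : HasC2Boundary U) {x : EuclideanSpace ℝ (Fin n)} (hx : x ∈ frontier U)
    {f : EuclideanSpace ℝ (Fin n) → ℝ} {g : EuclideanSpace ℝ (Fin n)}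
    (hf : HasGradientWithinAt f g (closure U) x) :
    HasDerivWithinAt (fun s : ℝ => f (x - s • outwardNormal U x))
      (-inner ℝ g (outwardNormal U x)) (Ici 0) 0 := by
  obtain ⟨s₀, hs₀, hs⟩ := h.exists_sub_smul_mem hx
  have hl : HasDerivWithinAt (fun s : ℝ => x - s • outwardNormal U x) (-outwardNormal U x)
      (Icc 0 s₀) 0 := by
    have := ((hasDerivAt_id (0 : ℝ)).smul_const (outwardNormal U x)).const_sub x
    simpa using this.hasDerivWithinAt
  have hmaps : MapsTo (fun s : ℝ => x - s • outwardNormal U x) (Icc 0 s₀) (closure U) := by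
    intro s hs'
    rcases hs'.1.eq_or_lt with h0 | h0
    · simpa [← h0] using frontier_subset_closure hx
    · exact subset_closure (hs s ⟨h0, hs'.2⟩)
  have hf' : HasFDerivWithinAt f ((InnerProductSpace.toDual ℝ _) g) (closure U)
      (x - (0 : ℝ) • outwardNormal U x) := by
    simpa using hf.hasFDerivWithinAt
  have := hf'.comp_hasDerivWithinAt (0 : ℝ) hl hmaps
  simp only [map_neg, InnerProductSpace.toDual_apply_apply] at this
  exact this.mono_of_mem_nhdsWithin (Icc_mem_nhdsGE hs₀)

/-! ### Second-order conditions at a maximum -/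

/-- A positive second derivative would make `a` a local minimum as well, so `f` would be locally
constant and the second derivative zero. -/
theorem IsLocalMax.deriv_deriv_nonpos {f : ℝ → ℝ} {a : ℝ} (h : IsLocalMax f a)
    (hc : ContinuousAt f a) : deriv (deriv f) a ≤ 0 := by
  by_contra hpos
  have hmin := isLocalMin_of_deriv_deriv_pos (not_le.1 hpos) h.deriv_eq_zero hc
  have heq : f =ᶠ[𝓝 a] fun _ => f a := by
    filter_upwards [h, hmin] with x h1 h2 using le_antisymm h1 h2
  have h1 : deriv f =ᶠ[𝓝 a] fun _ => 0 := by
    filter_upwards [heq.eventuallyEq_nhds] with x hx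
    rw [hx.deriv_eq, deriv_const]
  rw [h1.deriv_eq, deriv_const] at hpos
  exact hpos le_rfl

theorem IsLocalMax.iteratedFDeriv_two_nonpos {E : Type*} [NormedAddCommGroup E]
    [NormedSpace ℝ E] {f : E → ℝ} {x : E} (h : IsLocalMax f x) (hc : ContDiffAt ℝ 2 f x) (v : E) :
    iteratedFDeriv ℝ 2 f x ![v, v] ≤ 0 := by
  have hl : ∀ t : ℝ, HasDerivAt (fun s : ℝ => x + s • v) v t := fun t => by
    simpa using ((hasDerivAt_id t).smul_const v).const_add x
  have hl0 : Tendsto (fun s : ℝ => x + s • v) (𝓝 0) (𝓝 x) := by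
    simpa using (hl 0).continuousAt.tendsto
  have hd : ∀ᶠ y in 𝓝 x, DifferentiableAt ℝ f y := by
    filter_upwards [hc.eventually (by simp)] with y hy
    exact hy.differentiableAt (by norm_num)
  have h1 : deriv (fun s : ℝ => f (x + s • v)) =ᶠ[𝓝 0] fun s => fderiv ℝ f (x + s • v) v := by
    filter_upwards [hl0.eventually hd] with s hs
    exact (hs.hasFDerivAt.comp_hasDerivAt s (hl s)).deriv
  have h2 : deriv (deriv (fun s : ℝ => f (x + s • v))) 0 = fderiv ℝ (fderiv ℝ f) x v v := by
    rw [h1.deriv_eq]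
    have h3 : HasFDerivAt (fderiv ℝ f) (fderiv ℝ (fderiv ℝ f) x) (x + (0 : ℝ) • v) := by
      simpa using
        ((hc.fderiv_right (m := 1) (by norm_num)).differentiableAt (by norm_num)).hasFDerivAt
    have h4 : HasDerivAt (fun s : ℝ => fderiv ℝ f (x + s • v)) (fderiv ℝ (fderiv ℝ f) x v) 0 :=
      h3.comp_hasDerivAt (0 : ℝ) (hl 0)
    have h5 : HasDerivAt (fun s : ℝ => fderiv ℝ f (x + s • v) v)
        (fderiv ℝ (fderiv ℝ f) x v v) 0 :=
      ((ContinuousLinearMap.apply ℝ ℝ v).hasFDerivAt).comp_hasDerivAt (0 : ℝ) h4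
    exact h5.deriv
  have hmax : IsLocalMax (fun s : ℝ => f (x + s • v)) 0 := by
    have := hl0.eventually h
    simpa [IsLocalMax, IsMaxFilter] using this
  have hcont : ContinuousAt (fun s : ℝ => f (x + s • v)) 0 := by
    have : ContinuousAt f (x + (0 : ℝ) • v) := by simpa using hc.continuousAt
    exact this.comp (f := fun s : ℝ => x + s • v) (hl 0).continuousAt
  have := hmax.deriv_deriv_nonpos hcont
  rw [h2] at this
  simpa [iteratedFDeriv_two_apply] using this

theorem laplacian_eq_sum_single {n : ℕ} (f : EuclideanSpace ℝ (Fin n) → ℝ)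
    (x : EuclideanSpace ℝ (Fin n)) :
    Laplacian.laplacian f x = ∑ i : Fin n, iteratedFDeriv ℝ 2 f x
      ![EuclideanSpace.single i 1, EuclideanSpace.single i 1] := by
  rw [InnerProductSpace.laplacian_eq_iteratedFDeriv_orthonormalBasis f
    (EuclideanSpace.basisFun (Fin n) ℝ)]
  simp

theorem IsLocalMax.laplacian_nonpos {n : ℕ} {f : EuclideanSpace ℝ (Fin n) → ℝ}
    {x : EuclideanSpace ℝ (Fin n)} (h : IsLocalMax f x) (hc : ContDiffAt ℝ 2 f x) :
    Laplacian.laplacian f x ≤ 0 := by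
  rw [laplacian_eq_sum_single]
  exact Finset.sum_nonpos fun i _ => h.iteratedFDeriv_two_nonpos hc _

theorem divergence_gradient {n : ℕ} {f : EuclideanSpace ℝ (Fin n) → ℝ}
    {x : EuclideanSpace ℝ (Fin n)} (hc : ContDiffAt ℝ 2 f x) :
    divergence (gradient f) x = Laplacian.laplacian f x := by
  have h3 : DifferentiableAt ℝ (fderiv ℝ f) x :=
    (hc.fderiv_right (m := 1) (by norm_num)).differentiableAt (by norm_num)
  rw [laplacian_eq_sum_single, divergence]
  refine Finset.sum_congr rfl fun i _ => ?_
  have h4 : ∀ j, (fun y => gradient f y j) =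
      fun y => fderiv ℝ f y (EuclideanSpace.single j 1) := fun j => funext fun y => by
    rw [← inner_gradient_left, EuclideanSpace.inner_single_right]
    simp
  have h5 : ∀ j, HasFDerivAt (fun y => gradient f y j)
      ((ContinuousLinearMap.apply ℝ ℝ (EuclideanSpace.single j (1 : ℝ))).comp
        (fderiv ℝ (fderiv ℝ f) x)) x := fun j => by
    rw [h4]
    exact (ContinuousLinearMap.apply ℝ ℝ _).hasFDerivAt.comp x h3.hasFDerivAt
  have h6 : DifferentiableAt ℝ (gradient f) x :=
    differentiableAt_euclidean.2 fun j => (h5 j).differentiableAt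
  have h7 := ((EuclideanSpace.proj i : EuclideanSpace ℝ (Fin n) →L[ℝ] ℝ).hasFDerivAt.comp x
    h6.hasFDerivAt).unique (h5 i)
  have h8 := congrArg (fun L => L (EuclideanSpace.single i (1 : ℝ))) h7
  simpa [iteratedFDeriv_two_apply] using h8

/-- `Δ(R² - ‖x - y‖²) = -2n`. -/
theorem laplacian_sq_dist {n : ℕ} (c : ℝ) (y x : EuclideanSpace ℝ (Fin n)) :
    Laplacian.laplacian (fun z => c - ‖z - y‖ ^ 2) x = -(2 * n) := by
  have h1 : ∀ z, fderiv ℝ (fun z : EuclideanSpace ℝ (Fin n) => c - ‖z - y‖ ^ 2) z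
      = -(2 : ℝ) • innerSL ℝ (z - y) := fun z => by
    have := (((hasFDerivAt_id (𝕜 := ℝ) z).sub_const y).norm_sq).const_sub c
    simp only [id] at this
    rw [HasFDerivAt.fderiv this]
    ext v
    simp
  have h2 : fderiv ℝ (fderiv ℝ (fun z : EuclideanSpace ℝ (Fin n) => c - ‖z - y‖ ^ 2)) x
      = -(2 : ℝ) • innerSL ℝ := by
    rw [funext h1]
    exact (((innerSL ℝ (E := EuclideanSpace ℝ (Fin n))).hasFDerivAt.comp x
      ((hasFDerivAt_id x).sub_const y)).const_smul (-(2 : ℝ))).fderiv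
  rw [laplacian_eq_sum_single]
  have h3 : ∀ i : Fin n, innerSL ℝ (EuclideanSpace.single i (1 : ℝ) : EuclideanSpace ℝ (Fin n))
      (EuclideanSpace.single i 1) = 1 := fun i => by
    change inner ℝ (EuclideanSpace.single i (1 : ℝ) : EuclideanSpace ℝ (Fin n))
      (EuclideanSpace.single i 1) = (1 : ℝ)
    simp
  simp [iteratedFDeriv_two_apply, h2, h3]
  ring

/-! ### A comparison principle with Neumann condition -/

theorem HasDerivWithinAt.nonneg_of_eventually_ge {f : ℝ → ℝ} {d a : ℝ}
    (h : HasDerivWithinAt f d (Ici a) a) (hmin : ∀ᶠ s in 𝓝[>] a, f a ≤ f s) : 0 ≤ d := by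
  have h1 := (hasDerivWithinAt_iff_tendsto_slope' (by simp)).1 (h.mono Ioi_subset_Ici_self)
  refine ge_of_tendsto h1 ?_
  filter_upwards [hmin, self_mem_nhdsWithin] with s hs hs'
  rw [slope_def_field]
  exact div_nonneg (by linarith) (sub_nonneg.2 (le_of_lt hs'))

/-- Only slopes from the left enter, so the terminal time `t = T` is covered. -/
theorem derivWithin_Icc_nonneg_of_eventually_le {f : ℝ → ℝ} {t T : ℝ} (ht : t ∈ Ioc 0 T)
    (h : DifferentiableWithinAt ℝ f (Icc 0 T) t) (hmax : ∀ᶠ s in 𝓝[<] t, f s ≤ f t) :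
    0 ≤ derivWithin f (Icc 0 T) t := by
  have h0 : HasDerivWithinAt f (derivWithin f (Icc 0 T) t) (Iio t) t := by
    refine h.hasDerivWithinAt.mono_of_mem_nhdsWithin ?_
    filter_upwards [Ioo_mem_nhdsLT ht.1] with s hs using ⟨hs.1.le, hs.2.le.trans ht.2⟩
  have h1 := (hasDerivWithinAt_iff_tendsto_slope' (by simp)).1 h0
  refine ge_of_tendsto h1 ?_
  filter_upwards [hmax, self_mem_nhdsWithin] with s hs hs'
  rw [slope_def_field]
  exact div_nonneg_of_nonpos (by linarith) (sub_nonpos.2 (le_of_lt hs'))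

/-- The function `R² - ‖x - y‖² - K (τ - t)`, used as a barrier at a boundary point. -/
noncomputable def parabolicBarrier {n : ℕ} (R K τ : ℝ) (y : EuclideanSpace ℝ (Fin n)) (t : ℝ)
    (x : EuclideanSpace ℝ (Fin n)) : ℝ :=
  R ^ 2 - ‖x - y‖ ^ 2 - K * (τ - t)

theorem continuous_parabolicBarrier {n : ℕ} (R K τ : ℝ) (y : EuclideanSpace ℝ (Fin n)) :
    Continuous fun z : ℝ × EuclideanSpace ℝ (Fin n) => parabolicBarrier R K τ y z.1 z.2 := by
  unfold parabolicBarrier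
  fun_prop

/-- The barrier has time derivative `K` and Laplacian `-2n`; the first- and second-order conditions
at a maximum of the sum pass these to `w`. Taking `ε = 0` recovers the plain interior maximum. -/
theorem derivative_bounds_of_perturbed_max {n : ℕ} {w : ℝ → EuclideanSpace ℝ (Fin n) → ℝ}
    {T t : ℝ} {x y : EuclideanSpace ℝ (Fin n)} {ε R K τ : ℝ} (ht : t ∈ Ioc 0 T)
    (hd : DifferentiableWithinAt ℝ (fun s => w s x) (Icc 0 T) t) (hc : ContDiffAt ℝ 2 (w t) x)
    (hleft : ∀ᶠ s in 𝓝[<] t, w s x + ε * parabolicBarrier R K τ y s x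
      ≤ w t x + ε * parabolicBarrier R K τ y t x)
    (hmax : ∀ᶠ z in 𝓝 x, w t z + ε * parabolicBarrier R K τ y t z
      ≤ w t x + ε * parabolicBarrier R K τ y t x) :
    -(ε * K) ≤ derivWithin (fun s => w s x) (Icc 0 T) t ∧
      Laplacian.laplacian (w t) x ≤ ε * (2 * n) := by
  have hT : 0 < T := ht.1.trans_le ht.2
  constructor
  · have hu : UniqueDiffWithinAt ℝ (Icc 0 T) t :=
      (uniqueDiffOn_Icc hT) t ⟨ht.1.le, ht.2⟩
    have h1 : HasDerivWithinAt (fun s => w s x + ε * parabolicBarrier R K τ y s x)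
        (derivWithin (fun s => w s x) (Icc 0 T) t + ε * K) (Icc 0 T) t := by
      refine hd.hasDerivWithinAt.add (HasDerivAt.hasDerivWithinAt (HasDerivAt.const_mul ε ?_))
      unfold parabolicBarrier
      have := (((hasDerivAt_id t).const_sub τ).const_mul K).const_sub (R ^ 2 - ‖x - y‖ ^ 2)
      simpa using this
    have h2 := derivWithin_Icc_nonneg_of_eventually_le ht h1.differentiableWithinAt hleft
    rw [h1.derivWithin hu] at h2
    linarith
  · have hbd : ContDiff ℝ 2 fun z : EuclideanSpace ℝ (Fin n) =>
        (R ^ 2 - K * (τ - t)) - ‖z - y‖ ^ 2 :=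
      contDiff_const.sub ((contDiff_id.sub contDiff_const).norm_sq ℝ)
    have hb : ContDiffAt ℝ 2 (ε • fun z : EuclideanSpace ℝ (Fin n) =>
        (R ^ 2 - K * (τ - t)) - ‖z - y‖ ^ 2) x := hbd.contDiffAt.const_smul ε
    have hm : IsLocalMax (w t + ε • fun z : EuclideanSpace ℝ (Fin n) =>
        (R ^ 2 - K * (τ - t)) - ‖z - y‖ ^ 2) x := by
      filter_upwards [hmax] with z hz
      simp only [parabolicBarrier] at hz
      simp only [Pi.add_apply, Pi.smul_apply, smul_eq_mul]
      linarith
    have h3 := hm.laplacian_nonpos (hc.add hb)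
    rw [hc.laplacian_add hb, InnerProductSpace.laplacian_smul _ hbd.contDiffAt,
      laplacian_sq_dist] at h3
    simp only [smul_eq_mul] at h3
    linarith

/-- A positive maximum can only sit in `U` or on `Γe`. In `U` it contradicts the strict inequality
at once. On `Γe` a Hopf barrier forces a strictly positive outward derivative. The margin `c`,
uniform where `w ≥ m`, absorbs the barrier's derivatives, so the coefficient `a` need only be
bounded above and may degenerate. -/
theorem parabolic_comparison {n : ℕ} {U Γi Γe : Set (EuclideanSpace ℝ (Fin n))}
    (hU : IsReservoir U Γi Γe) {T : ℝ} {w : ℝ → EuclideanSpace ℝ (Fin n) → ℝ}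
    (hcont : ContinuousOn (fun z : ℝ × EuclideanSpace ℝ (Fin n) => w z.1 z.2)
      (Icc 0 T ×ˢ closure U))
    (hinit : ∀ x ∈ closure U, w 0 x ≤ 0)
    (hdir : ∀ t ∈ Icc 0 T, ∀ x ∈ Γi, w t x ≤ 0)
    (hneu : ∀ t ∈ Ioc 0 T, ∀ x ∈ Γe, ∃ g, HasGradientWithinAt (w t) g (closure U) x ∧
      inner ℝ g (outwardNormal U x) ≤ 0)
    (hdiff : ∀ t ∈ Ioc 0 T, ∀ x ∈ U, DifferentiableWithinAt ℝ (fun s => w s x) (Icc 0 T) t)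
    (hC2 : ∀ t ∈ Ioc 0 T, ∀ x ∈ U, ContDiffAt ℝ 2 (w t) x) {a₀ : ℝ} (ha₀ : 0 ≤ a₀)
    (hineq : ∀ m > 0, ∃ c > 0, ∀ t ∈ Ioc 0 T, ∀ x ∈ U, m ≤ w t x → ∃ a ∈ Icc 0 a₀,
      derivWithin (fun s => w s x) (Icc 0 T) t ≤ a * Laplacian.laplacian (w t) x - c) :
    ∀ t ∈ Icc 0 T, ∀ x ∈ closure U, w t x ≤ 0 := by
  by_contra! hcon
  obtain ⟨t', ht', x', hx', hpos⟩ := hcon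
  have hcpt : IsCompact (Icc 0 T ×ˢ closure U) := isCompact_Icc.prod hU.bounded.isCompact_closure
  obtain ⟨⟨τ, ξ⟩, hmem, hM⟩ := hcpt.exists_isMaxOn ⟨(t', x'), ht', hx'⟩ hcont
  obtain ⟨hτ, hξ⟩ : τ ∈ Icc 0 T ∧ ξ ∈ closure U := hmem
  have hM' : ∀ t ∈ Icc 0 T, ∀ x ∈ closure U, w t x ≤ w τ ξ := fun t ht x hx => hM (mk_mem_prod ht hx)
  set M := w τ ξ with hMdef
  have hMpos : 0 < M := hpos.trans_le (hM' t' ht' x' hx')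
  have hτ0 : 0 < τ := by
    refine hτ.1.lt_of_ne fun h0 => ?_
    have := hinit ξ hξ
    rw [h0] at this
    linarith
  have hτT : τ ∈ Ioc 0 T := ⟨hτ0, hτ.2⟩
  obtain ⟨c, hc, hcw⟩ := hineq (M / 2) (by linarith)
  by_cases hξU : ξ ∈ U
  · obtain ⟨h1, h2⟩ := derivative_bounds_of_perturbed_max (w := w) (y := ξ) (ε := 0) (R := 0)
      (K := 0) (τ := 0) hτT (hdiff τ hτT ξ hξU) (hC2 τ hτT ξ hξU)
      (by
        filter_upwards [Ioo_mem_nhdsLT hτ0] with s hs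
        simpa using hM' s ⟨hs.1.le, hs.2.le.trans hτ.2⟩ ξ hξ)
      (by
        filter_upwards [hU.isOpen.mem_nhds hξU] with z hz
        simpa using hM' τ hτ z (subset_closure hz))
    obtain ⟨a, ha, hle⟩ := hcw τ hτT ξ hξU (by linarith)
    have := mul_nonneg ha.1 (neg_nonneg.2 (h2.trans_eq (zero_mul _)))
    linarith
  · have hξf : ξ ∈ frontier U := by
      rw [hU.isOpen.frontier_eq]
      exact ⟨hξ, hξU⟩
    have hξe : ξ ∈ Γe := by
      have := hU.boundary_eq ▸ hξf
      exact this.resolve_left fun hi => (hdir τ hτ ξ hi).not_gt hMpos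
    obtain ⟨g, hg, hgN⟩ := hneu τ hτT ξ hξe
    have hder := hU.boundary_C2.hasDerivWithinAt_normal hξf hg
    have hN := hU.boundary_C2.norm_outwardNormal hξf
    obtain ⟨R₀, hR₀, hball⟩ := hU.boundary_C2.exists_ball_subset hξf
    set N := outwardNormal U ξ with hNdef
    have hev : ∀ᶠ z in 𝓝[Icc 0 T ×ˢ closure U] (τ, ξ), M / 2 < w z.1 z.2 :=
      (hcont (τ, ξ) ⟨hτ, hξ⟩).eventually_const_lt (by change M / 2 < M; linarith)
    obtain ⟨r, hr, hrw⟩ := Metric.mem_nhdsWithin_iff.1 hev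
    -- The closed ball about `y` lies within distance `2R < r` of `ξ`, where `w > M/2`.
    set R := min R₀ (r / 3) with hRdef
    have hR : 0 < R := by positivity
    have hRr : 2 * R < r := by
      have : R ≤ r / 3 := min_le_right _ _
      linarith
    set y := ξ - R • N with hy
    have hyU : Metric.ball y R ⊆ U := hball R ⟨hR, min_le_left _ _⟩
    have hyU' : Metric.closedBall y R ⊆ closure U := by
      rw [← closure_ball y hR.ne']
      exact closure_mono hyU
    have hξy : dist ξ y = R := by
      rw [dist_eq_norm, hy, sub_sub_cancel, norm_smul, hN, mul_one, Real.norm_of_nonneg hR.le]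
    set δ := min (r / 2) (τ / 2) with hδdef
    have hδ : 0 < δ := by positivity
    have hδr : δ < r := (min_le_left _ _).trans_lt (by linarith)
    have hδτ : δ < τ := (min_le_right _ _).trans_lt (by linarith)
    -- With this slope, nonnegativity of the barrier forces `τ - t ≤ δ < τ`, so the region `D` stays
    -- near `(τ, ξ)` and away from the initial time.
    set K := R ^ 2 / δ with hKdef
    have hK : 0 < K := by positivity
    have hKδ : K * δ = R ^ 2 := div_mul_cancel₀ _ hδ.ne'
    set h := fun z : ℝ × EuclideanSpace ℝ (Fin n) => parabolicBarrier R K τ y z.1 z.2 with hh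
    have hhc : Continuous h := continuous_parabolicBarrier R K τ y
    set D : Set (ℝ × EuclideanSpace ℝ (Fin n)) :=
      (Icc 0 τ ×ˢ Metric.closedBall y R) ∩ {z | 0 ≤ h z} with hD
    have hDc : IsCompact D :=
      (isCompact_Icc.prod (isCompact_closedBall y R)).inter_right (isClosed_le continuous_const hhc)
    have hDsub : D ⊆ Icc 0 T ×ˢ closure U := fun z hz =>
      ⟨⟨hz.1.1.1, hz.1.1.2.trans hτ.2⟩, hyU' hz.1.2⟩
    have hDt : ∀ z ∈ D, τ - z.1 ≤ δ := fun z hz => by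
      have h1 : 0 ≤ R ^ 2 - ‖z.2 - y‖ ^ 2 - K * (τ - z.1) := hz.2
      have h2 : K * (τ - z.1) ≤ K * δ := by nlinarith [sq_nonneg ‖z.2 - y‖]
      exact le_of_mul_le_mul_left h2 hK
    have hDw : ∀ z ∈ D, M / 2 < w z.1 z.2 := fun z hz => by
      refine hrw ⟨?_, hDsub hz⟩
      rw [Metric.mem_ball, Prod.dist_eq]
      refine max_lt ?_ ?_
      · have h1 := hDt z hz
        have h2 := hz.1.1.2
        rw [Real.dist_eq, abs_lt]
        constructor <;> linarith
      · calc dist z.2 ξ ≤ dist z.2 y + dist ξ y := dist_triangle_right _ _ _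
          _ ≤ R + R := add_le_add hz.1.2 hξy.le
          _ < r := by linarith
    have hξD : (τ, ξ) ∈ D := by
      refine ⟨⟨⟨hτ.1, le_rfl⟩, hξy.le⟩, ?_⟩
      change 0 ≤ R ^ 2 - ‖ξ - y‖ ^ 2 - K * (τ - τ)
      rw [← dist_eq_norm, hξy]
      simp
    -- Small enough that `ε(K + 2n·a₀) < c`: the perturbation cannot use up the strict margin.
    set ε := c / (K + a₀ * (2 * n) + 1) with hεdef
    have hε : 0 < ε := by positivity
    have hεc : ε * (K + a₀ * (2 * n)) < c := by
      have : ε * (K + a₀ * (2 * n) + 1) = c := div_mul_cancel₀ _ (by positivity)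
      linarith
    have hDmax : ∀ z ∈ D, w z.1 z.2 + ε * h z ≤ M := by
      obtain ⟨⟨t₁, x₁⟩, hz₁, hmax⟩ := hDc.exists_isMaxOn ⟨_, hξD⟩
        ((hcont.mono hDsub).add (hhc.continuousOn.const_smul ε))
      refine fun z hz => (hmax hz).trans ?_
      have hle : w t₁ x₁ ≤ M := hM (hDsub hz₁)
      -- Where the barrier vanishes the bound is `w ≤ M`; where it is positive the maximum over `D`
      -- satisfies the interior conditions in space and from the left in time, which is impossible.
      rcases (show 0 ≤ h (t₁, x₁) from hz₁.2).eq_or_lt with h0 | h0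
      · simpa [← h0] using hle
      exfalso
      have ht₁ : 0 < t₁ := by
        have := hDt _ hz₁
        linarith
      have ht₁T : t₁ ∈ Ioc 0 T := ⟨ht₁, hz₁.1.1.2.trans hτ.2⟩
      have hinD : ∀ s x, s ∈ Icc 0 τ → 0 < h (s, x) → (s, x) ∈ D ∧ x ∈ U := fun s x hs hp => by
        have h1 : 0 < R ^ 2 - ‖x - y‖ ^ 2 - K * (τ - s) := hp
        have h2 : 0 ≤ K * (τ - s) := mul_nonneg hK.le (sub_nonneg.2 hs.2)
        have h3 : dist x y < R := by
          rw [dist_eq_norm]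
          exact lt_of_pow_lt_pow_left₀ 2 hR.le (by linarith)
        exact ⟨⟨⟨hs, h3.le⟩, hp.le⟩, hyU h3⟩
      have hx₁U : x₁ ∈ U := (hinD t₁ x₁ hz₁.1.1 h0).2
      obtain ⟨h1, h2⟩ := derivative_bounds_of_perturbed_max (w := w) (y := y) (ε := ε) (R := R)
        (K := K) (τ := τ) ht₁T (hdiff t₁ ht₁T x₁ hx₁U) (hC2 t₁ ht₁T x₁ hx₁U)
        (by
          have hev1 : ∀ᶠ s in 𝓝 t₁, 0 < h (s, x₁) :=
            (hhc.comp (Continuous.prodMk_left x₁)).continuousAt.eventually_const_lt h0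
          filter_upwards [Ioo_mem_nhdsLT ht₁, nhdsWithin_le_nhds hev1] with s hs hs'
          exact hmax (hinD s x₁ ⟨hs.1.le, hs.2.le.trans hz₁.1.1.2⟩ hs').1)
        (by
          have hev1 : ∀ᶠ x in 𝓝 x₁, 0 < h (t₁, x) :=
            (hhc.comp (Continuous.prodMk_right t₁)).continuousAt.eventually_const_lt h0
          filter_upwards [hev1] with x hx
          exact hmax (hinD t₁ x hz₁.1.1 hx).1)
      obtain ⟨a, ha, hle'⟩ := hcw t₁ ht₁T x₁ hx₁U (hDw _ hz₁).le
      have h3 : a * Laplacian.laplacian (w t₁) x₁ ≤ a₀ * (ε * (2 * n)) :=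
        (mul_le_mul_of_nonneg_left h2 ha.1).trans
          (mul_le_mul_of_nonneg_right ha.2 (by positivity))
      nlinarith
    -- Along the inward normal the perturbed function is maximal at `s = 0`, whence `⟪g, N⟫ ≥ 2εR >
    -- 0`, against the Neumann sign.
    have hder' : HasDerivWithinAt
        (fun s : ℝ => -(w τ (ξ - s • N) + ε * (R ^ 2 - (R - s) ^ 2)))
        (-(-inner ℝ g N + ε * (2 * R))) (Ici 0) 0 := by
      refine (hder.add (HasDerivAt.hasDerivWithinAt (HasDerivAt.const_mul ε ?_))).neg
      have := (((hasDerivAt_id (0 : ℝ)).const_sub R).pow 2).const_sub (R ^ 2)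
      simpa using this
    have := hder'.nonneg_of_eventually_ge (by
      filter_upwards [Ioo_mem_nhdsGT hR] with s hs
      have hdist : ‖ξ - s • N - y‖ = R - s := by
        have : ξ - s • N - y = (R - s) • N := by rw [hy, sub_smul]; abel
        rw [this, norm_smul, hN, mul_one, Real.norm_of_nonneg (by linarith [hs.2])]
      have hhs : h (τ, ξ - s • N) = R ^ 2 - (R - s) ^ 2 := by
        simp only [hh, parabolicBarrier, hdist]
        ring
      have hsD : (τ, ξ - s • N) ∈ D := by
        refine ⟨⟨⟨hτ.1, le_rfl⟩, ?_⟩, ?_⟩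
        · rw [Metric.mem_closedBall, dist_eq_norm, hdist]
          linarith [hs.1]
        · change 0 ≤ h (τ, ξ - s • N)
          rw [hhs]
          nlinarith [hs.1, hs.2]
      have := hDmax _ hsD
      rw [hhs] at this
      simp only [zero_smul, sub_zero, sub_self, mul_zero, add_zero]
      exact neg_le_neg this)
    nlinarith

/-! ### Surface measure of a `C²` boundary -/

open Module in
theorem finrank_orthogonal_unit {n : ℕ} {N : EuclideanSpace ℝ (Fin n)} (hN : ‖N‖ = 1) :
    finrank ℝ (ℝ ∙ N)ᗮ = n - 1 := by
  have hN0 : N ≠ 0 := by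
    rintro rfl
    simp at hN
  have := Submodule.finrank_add_finrank_orthogonal (𝕜 := ℝ) (ℝ ∙ N)
  rw [finrank_span_singleton hN0, finrank_euclideanSpace_fin] at this
  omega

theorem coe_projection_orthogonal_unit {n : ℕ} {N : EuclideanSpace ℝ (Fin n)} (hN : ‖N‖ = 1)
    (v : EuclideanSpace ℝ (Fin n)) :
    ((ℝ ∙ N)ᗮ.orthogonalProjectionOnto v : EuclideanSpace ℝ (Fin n)) = v - inner ℝ N v • N := by
  have := Submodule.starProjection_orthogonal_val (K := ℝ ∙ N) v
  rw [Submodule.starProjection_unit_singleton ℝ hN] at this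
  simpa using this

/-- Strict differentiability with tolerance half the gradient norm. Both points vary, as is needed
to see the zero set as a Lipschitz graph over the tangent hyperplane. -/
theorem IsLocalDefiningFunction.exists_strict_estimate {n : ℕ}
    {U : Set (EuclideanSpace ℝ (Fin n))} {x : EuclideanSpace ℝ (Fin n)}
    {φ : EuclideanSpace ℝ (Fin n) → ℝ} (h : IsLocalDefiningFunction U x φ) :
    ∃ r > 0, ∀ y ∈ Metric.ball x r, (y ∈ U ↔ φ y < 0) ∧ ∀ z ∈ Metric.ball x r,
      |φ y - φ z - ‖gradient φ x‖ * inner ℝ (outwardNormal U x) (y - z)|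
        ≤ ‖gradient φ x‖ / 2 * ‖y - z‖ := by
  have hs := h.contDiffAt.hasStrictFDerivAt (by norm_num)
  have hN := h.outwardNormal_eq
  obtain ⟨V, hV, -, -, hg, hU⟩ := h
  have hgn : 0 < ‖gradient φ x‖ := norm_pos_iff.2 hg
  have h1 := (hasStrictFDerivAt_iff_isLittleO.1 hs).bound (half_pos hgn)
  rw [nhds_prod_eq] at h1
  obtain ⟨t, ht, ht'⟩ := mem_prod_self_iff.1 h1
  obtain ⟨r, hr, hrt⟩ := Metric.mem_nhds_iff.1 (inter_mem ht hV)
  refine ⟨r, hr, fun y hy => ⟨hU y (hrt hy).2, fun z hz => ?_⟩⟩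
  have := ht' (mk_mem_prod (hrt hy).1 (hrt hz).1)
  rw [hN, real_inner_smul_left, ← mul_assoc, mul_inv_cancel₀ hgn.ne', one_mul, inner_gradient_left]
  exact this

/-- A segment missing the frontier would be split by the disjoint open sets `U` and the complement
of its closure. -/
theorem exists_mem_frontier_of_segment {E : Type*} [NormedAddCommGroup E] [NormedSpace ℝ E]
    {U : Set E} (hU : IsOpen U) {a v : E} {δ : ℝ} (hδ : 0 ≤ δ) (h1 : a - δ • v ∈ U)
    (h2 : a + δ • v ∉ U) : ∃ s ∈ Icc (-δ) δ, a + s • v ∈ frontier U := by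
  by_contra! hcon
  have hpre : IsPreconnected ((fun s : ℝ => a + s • v) '' Icc (-δ) δ) :=
    isPreconnected_Icc.image _ (by fun_prop)
  have hsub := IsPreconnected.subset_left_of_subset_union hU isClosed_closure.isOpen_compl
    (disjoint_compl_right.mono_left subset_closure) (s := (fun s : ℝ => a + s • v) '' Icc (-δ) δ)
    (by
      rintro _ ⟨s, hs, rfl⟩
      by_contra hns
      rw [mem_union, not_or, notMem_compl_iff] at hns
      exact hcon s hs (by rw [hU.frontier_eq]; exact ⟨hns.2, hns.1⟩))
    ⟨a - δ • v, ⟨-δ, ⟨le_rfl, by linarith⟩, by simp [sub_eq_add_neg]⟩, h1⟩ hpre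
  exact h2 (hsub ⟨δ, ⟨by linarith, le_rfl⟩, rfl⟩)

/-- On the zero set, the normal part of `y - z` is at most half its length, so projection to the
tangent hyperplane has a 2-Lipschitz inverse. The patch is then a Lipschitz image of a bounded set
in dimension `n - 1`. -/
theorem HasC2Boundary.exists_hausdorffMeasure_lt_top {n : ℕ}
    {U : Set (EuclideanSpace ℝ (Fin n))} (hU : IsOpen U) (h : HasC2Boundary U)
    {x : EuclideanSpace ℝ (Fin n)} (hx : x ∈ frontier U) :
    ∃ t ∈ 𝓝[frontier U] x, Measure.hausdorffMeasure ((n - 1 : ℕ) : ℝ) t < ⊤ := by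
  obtain ⟨φ, hφ⟩ := h x hx
  obtain ⟨r, hr, hest⟩ := hφ.exists_strict_estimate
  have hN := hφ.norm_outwardNormal
  have hgn : 0 < ‖gradient φ x‖ := by
    obtain ⟨V, -, -, -, hg, -⟩ := hφ
    exact norm_pos_iff.2 hg
  set N := outwardNormal U x with hNdef
  set P := (ℝ ∙ N)ᗮ.orthogonalProjectionOnto with hP
  set S : Set (EuclideanSpace ℝ (Fin n)) := {y | φ y = 0} ∩ Metric.ball x r with hS
  have hanti : ∀ y ∈ S, ∀ z ∈ S, dist y z ≤ 2 * dist (P y) (P z) := by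
    intro y hy z hz
    have h1 := (hest y hy.2).2 z hz.2
    have hy0 : φ y = 0 := hy.1
    have hz0 : φ z = 0 := hz.1
    rw [hy0, hz0, sub_zero, zero_sub, abs_neg, abs_mul, abs_of_pos hgn, div_mul_eq_mul_div,
      mul_div_assoc] at h1
    have h2 := le_of_mul_le_mul_left h1 hgn
    have h3 : y - z = (P (y - z) : EuclideanSpace ℝ (Fin n)) + inner ℝ N (y - z) • N := by
      rw [hP, coe_projection_orthogonal_unit hN]
      abel
    have h4 : ‖y - z‖ ≤ ‖P (y - z)‖ + |inner ℝ N (y - z)| := by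
      conv_lhs => rw [h3]
      refine (norm_add_le _ _).trans ?_
      rw [norm_smul, hN, mul_one, Real.norm_eq_abs, Submodule.coe_norm]
    rw [dist_eq_norm, dist_eq_norm, ← map_sub]
    linarith
  refine ⟨S, ?_, ?_⟩
  · filter_upwards [hφ.eventually_frontier hU, nhdsWithin_le_nhds (Metric.ball_mem_nhds x hr)]
      with y hy hyr
    obtain ⟨V, -, -, h0, -⟩ := hy
    exact ⟨h0, hyr⟩
  · have hinj : InjOn P S := fun y hy z hz hyz => by
      have := hanti y hy z hz
      rw [hyz, dist_self, mul_zero] at this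
      exact dist_le_zero.1 this
    have hinv := hinj.leftInvOn_invFunOn
    have hlip : LipschitzOnWith 2 (Function.invFunOn P S) (P '' S) := by
      refine LipschitzOnWith.of_dist_le_mul ?_
      rintro _ ⟨y, hy, rfl⟩ _ ⟨z, hz, rfl⟩
      rw [hinv hy, hinv hz]
      exact hanti y hy z hz
    have himg := hlip.hausdorffMeasure_image_le (d := ((n - 1 : ℕ) : ℝ)) (Nat.cast_nonneg _)
    rw [hinv.image_image] at himg
    refine himg.trans_lt (ENNReal.mul_lt_top (by simp) ?_)
    rw [← finrank_orthogonal_unit hN]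
    refine Bornology.IsBounded.measure_lt_top ?_
    exact P.lipschitz.isBounded_image (Metric.isBounded_ball.subset inter_subset_right)

/-- Every normal line close to `x` crosses from `U` to its complement, so the projected patch
contains a ball of the tangent hyperplane, and projection does not increase Hausdorff measure. -/
theorem HasC2Boundary.hausdorffMeasure_frontier_inter_ball_pos {n : ℕ}
    {U : Set (EuclideanSpace ℝ (Fin n))} (hU : IsOpen U) (h : HasC2Boundary U)
    {x : EuclideanSpace ℝ (Fin n)} (hx : x ∈ frontier U) {ρ : ℝ} (hρ : 0 < ρ) :
    0 < Measure.hausdorffMeasure ((n - 1 : ℕ) : ℝ) (frontier U ∩ Metric.ball x ρ) := by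
  obtain ⟨φ, hφ⟩ := h x hx
  obtain ⟨r', hr', hest⟩ := hφ.exists_strict_estimate
  have hN := hφ.norm_outwardNormal
  obtain ⟨hφ0, hgn⟩ : φ x = 0 ∧ 0 < ‖gradient φ x‖ := by
    obtain ⟨V, -, -, h0, hg, -⟩ := hφ
    exact ⟨h0, norm_pos_iff.2 hg⟩
  set N := outwardNormal U x with hNdef
  set P := (ℝ ∙ N)ᗮ.orthogonalProjectionOnto with hP
  set r := min r' ρ with hr
  have hrpos : 0 < r := lt_min hr' hρ
  set δ := r / 2 with hδ
  have hδpos : 0 < δ := by positivity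
  have hPN : ∀ s : ℝ, P (s • N) = 0 := fun s =>
    Submodule.orthogonalProjectionOnto_orthogonal_apply_eq_zero
      (Submodule.smul_mem _ _ (Submodule.mem_span_singleton_self N))
  have hcover : Metric.ball (P x) (δ / 2) ⊆ P '' (frontier U ∩ Metric.ball x ρ) := by
    intro p hp
    set u := p - P x with hu
    have hun : ‖(u : EuclideanSpace ℝ (Fin n))‖ < δ / 2 := by
      rw [← Submodule.coe_norm, hu, ← dist_eq_norm]
      exact hp
    have huN : inner ℝ N (u : EuclideanSpace ℝ (Fin n)) = 0 :=
      Submodule.mem_orthogonal_singleton_iff_inner_right.1 u.2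
    have hball : ∀ s ∈ Icc (-δ) δ, x + u + s • N ∈ Metric.ball x r := by
      intro s hs
      rw [Metric.mem_ball, dist_eq_norm, add_assoc, add_sub_cancel_left]
      refine (norm_add_le _ _).trans_lt ?_
      rw [norm_smul, hN, mul_one, Real.norm_eq_abs]
      have := abs_le.2 hs
      linarith
    -- At `s = ±δ` the error is at most `¾‖∇φ(x)‖δ`, less than the main term, so the sign of `φ` is
    -- that of `s`.
    have hval : ∀ s ∈ Icc (-δ) δ,
        |φ (x + u + s • N) - ‖gradient φ x‖ * s| ≤ ‖gradient φ x‖ / 2 * (δ / 2 + |s|) := by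
      intro s hs
      have h1 := (hest _ (Metric.ball_subset_ball (min_le_left _ _) (hball s hs))).2 x
        (Metric.mem_ball_self hr')
      have h2 : x + u + s • N - x = u + s • N := by abel
      rw [hφ0, sub_zero, h2, inner_add_right, huN, inner_smul_right, real_inner_self_eq_norm_sq,
        hN, zero_add, one_pow, mul_one] at h1
      refine h1.trans ?_
      gcongr
      refine (norm_add_le _ _).trans ?_
      rw [norm_smul, hN, mul_one, Real.norm_eq_abs]
      linarith
    have hin : x + u - δ • N ∈ U := by
      have hmem : -δ ∈ Icc (-δ) δ := ⟨le_rfl, by linarith⟩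
      have h1 := hval _ hmem
      have h2 := hball _ hmem
      rw [neg_smul, ← sub_eq_add_neg] at h1 h2
      rw [(hest _ (Metric.ball_subset_ball (min_le_left _ _) h2)).1]
      rw [abs_neg, abs_of_pos hδpos] at h1
      have := (abs_le.1 h1).2
      nlinarith
    have hout : x + u + δ • N ∉ U := by
      have hmem : δ ∈ Icc (-δ) δ := ⟨by linarith, le_rfl⟩
      have h1 := hval _ hmem
      rw [(hest _ (Metric.ball_subset_ball (min_le_left _ _) (hball _ hmem))).1, not_lt]
      rw [abs_of_pos hδpos] at h1
      have := (abs_le.1 h1).1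
      nlinarith
    obtain ⟨s, hs, hsf⟩ := exists_mem_frontier_of_segment hU hδpos.le hin hout
    refine ⟨_, ⟨hsf, Metric.ball_subset_ball (min_le_right _ _) (hball s hs)⟩, ?_⟩
    rw [map_add, map_add, hPN, add_zero, hP, Submodule.orthogonalProjectionOnto_mem_subspace_eq_self]
    rw [hu, add_sub_cancel]
  have hpos : 0 < Measure.hausdorffMeasure ((n - 1 : ℕ) : ℝ) (Metric.ball (P x) (δ / 2)) := by
    rw [← finrank_orthogonal_unit hN]
    exact Metric.measure_ball_pos _ _ (by positivity)
  have hle := (Submodule.lipschitzWith_orthogonalProjectionOnto (ℝ ∙ N)ᗮ).hausdorffMeasure_image_le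
    (d := ((n - 1 : ℕ) : ℝ)) (Nat.cast_nonneg _) (frontier U ∩ Metric.ball x ρ)
  rw [ENNReal.coe_one, ENNReal.one_rpow, one_mul] at hle
  exact hpos.trans_le ((measure_mono hcover).trans hle)

theorem surfaceMeasure_eq_smul (n : ℕ) : ∃ c : NNReal, c ≠ 0 ∧
    surfaceMeasure n = c • Measure.hausdorffMeasure ((n - 1 : ℕ) : ℝ) :=
  ⟨_, Measure.addHaarScalarFactor_volume_hausdorffMeasure_ne_zero (n - 1),
    Measure.euclideanHausdorffMeasure_def (n - 1)⟩

namespace IsReservoir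

variable {n : ℕ} {U Γi Γe : Set (EuclideanSpace ℝ (Fin n))}

theorem isCompact_closure (hU : IsReservoir U Γi Γe) : IsCompact (closure U) :=
  hU.bounded.isCompact_closure

theorem well_subset_frontier (hU : IsReservoir U Γi Γe) : Γi ⊆ frontier U :=
  hU.boundary_eq ▸ subset_union_left

theorem ext_subset_frontier (hU : IsReservoir U Γi Γe) : Γe ⊆ frontier U :=
  hU.boundary_eq ▸ subset_union_right

theorem well_subset_closure (hU : IsReservoir U Γi Γe) : Γi ⊆ closure U :=
  hU.well_subset_frontier.trans frontier_subset_closure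

theorem ext_subset_closure (hU : IsReservoir U Γi Γe) : Γe ⊆ closure U :=
  hU.ext_subset_frontier.trans frontier_subset_closure

theorem isCompact_well (hU : IsReservoir U Γi Γe) : IsCompact Γi :=
  hU.isCompact_closure.of_isClosed_subset hU.closed_well hU.well_subset_closure

theorem surfaceMeasure_well_lt_top (hU : IsReservoir U Γi Γe) :
    surfaceMeasure n Γi < ⊤ := by
  obtain ⟨c, -, hc⟩ := surfaceMeasure_eq_smul n
  rw [hc, Measure.smul_apply]
  refine ENNReal.nnreal_smul_lt_top ?_
  refine hU.isCompact_well.measure_lt_top_of_nhdsWithin fun x hx => ?_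
  obtain ⟨t, ht, ht'⟩ := hU.boundary_C2.exists_hausdorffMeasure_lt_top hU.isOpen
    (hU.well_subset_frontier hx)
  exact ⟨t, nhdsWithin_mono _ hU.well_subset_frontier ht, ht'⟩

/-- Since `Γe` is closed and disjoint from `Γi`, the whole frontier near a well point belongs to the
well. -/
theorem surfaceMeasure_well_pos (hU : IsReservoir U Γi Γe) : 0 < surfaceMeasure n Γi := by
  obtain ⟨c, hc0, hc⟩ := surfaceMeasure_eq_smul n
  obtain ⟨x, hx⟩ := hU.well_nonempty
  have hxe : Γeᶜ ∈ 𝓝 x := hU.closed_ext.isOpen_compl.mem_nhds (hU.disjoint.notMem_of_mem_left hx)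
  obtain ⟨ρ, hρ, hsub⟩ := Metric.mem_nhds_iff.1 hxe
  have hpos := hU.boundary_C2.hausdorffMeasure_frontier_inter_ball_pos hU.isOpen
    (hU.well_subset_frontier hx) hρ
  have hle : frontier U ∩ Metric.ball x ρ ⊆ Γi := fun y hy =>
    (hU.boundary_eq ▸ hy.1 : y ∈ Γi ∪ Γe).resolve_right (hsub hy.2)
  rw [hc, Measure.smul_apply, pos_iff_ne_zero]
  have h1 := (hpos.trans_le (measure_mono hle)).ne'
  simpa [ENNReal.smul_def, hc0] using h1

theorem nonempty (hU : IsReservoir U Γi Γe) : U.Nonempty := by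
  obtain ⟨x, hx⟩ := hU.well_nonempty
  exact closure_nonempty_iff.1 ⟨x, hU.well_subset_closure hx⟩

theorem volume_ne_zero (hU : IsReservoir U Γi Γe) : volume U ≠ 0 :=
  (hU.isOpen.measure_pos volume hU.nonempty).ne'

theorem volume_ne_top (hU : IsReservoir U Γi Γe) : volume U ≠ ⊤ :=
  hU.bounded.measure_lt_top.ne

end IsReservoir

/-! ### The Darcy operators in terms of the Laplacian -/

theorem K₂_zero {α : ℝ} (hα : 0 < α) (ξ : ℝ) : K₂ α 0 ξ = α⁻¹ := by
  rw [K₂, mul_zero, zero_mul, add_zero, Real.sqrt_sq hα.le]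
  field_simp
  norm_num

theorem grad_eq_gradient {n : ℕ} {U : Set (EuclideanSpace ℝ (Fin n))} (hU : IsOpen U)
    (f : EuclideanSpace ℝ (Fin n) → ℝ) {x : EuclideanSpace ℝ (Fin n)} (hx : x ∈ U) :
    grad U f x = gradient f x := by
  rw [grad, gradientWithin, gradient,
    fderivWithin_of_mem_nhds (mem_of_superset (hU.mem_nhds hx) subset_closure)]

theorem grad_congr {n : ℕ} {U : Set (EuclideanSpace ℝ (Fin n))}
    {f g : EuclideanSpace ℝ (Fin n) → ℝ} (h : EqOn f g (closure U))
    {x : EuclideanSpace ℝ (Fin n)} (hx : x ∈ closure U) : grad U f x = grad U g x := by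
  rw [grad, grad, gradientWithin, gradientWithin, fderivWithin_congr h (h hx)]

theorem hasGradientWithinAt_grad {n : ℕ} {U : Set (EuclideanSpace ℝ (Fin n))}
    {f : EuclideanSpace ℝ (Fin n) → ℝ} {x : EuclideanSpace ℝ (Fin n)}
    (h : DifferentiableWithinAt ℝ f (closure U) x) :
    HasGradientWithinAt f (grad U f x) (closure U) x :=
  h.hasGradientWithinAt

section gradient

variable {E : Type*} [NormedAddCommGroup E] [InnerProductSpace ℝ E] [CompleteSpace E]
  {f h : E → ℝ} {f' h' x : E} {s : Set E}

theorem HasGradientWithinAt.fun_sq (hf : HasGradientWithinAt f f' s x) :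
    HasGradientWithinAt (fun y => f y ^ 2) ((2 * f x) • f') s x := by
  rw [hasGradientWithinAt_iff_hasFDerivWithinAt] at hf ⊢
  have := hf.pow 2
  simpa using this

theorem HasGradientWithinAt.linear_comb (hf : HasGradientWithinAt f f' s x)
    (hh : HasGradientWithinAt h h' s x) (a b c : ℝ) :
    HasGradientWithinAt (fun y => a * f y + b * h y + c) (a • f' + b • h') s x := by
  rw [hasGradientWithinAt_iff_hasFDerivWithinAt] at hf hh ⊢
  have := ((hf.const_mul a).add (hh.const_mul b)).add_const c
  simpa using this

end gradient

theorem laplacian_linear_comb {n : ℕ} {f h : EuclideanSpace ℝ (Fin n) → ℝ}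
    {x : EuclideanSpace ℝ (Fin n)} (hf : ContDiffAt ℝ 2 f x) (hh : ContDiffAt ℝ 2 h x)
    (a b c : ℝ) : Laplacian.laplacian (fun y => a * f y + b * h y + c) x =
      a * Laplacian.laplacian f x + b * Laplacian.laplacian h x := by
  have h1 : ContDiffAt ℝ 2 (a • f) x := hf.const_smul a
  have h2 : ContDiffAt ℝ 2 (b • h) x := hh.const_smul b
  have h3 : ContDiffAt ℝ 2 (fun _ : EuclideanSpace ℝ (Fin n) => c) x := contDiffAt_const
  have h4 : (fun y => a * f y + b * h y + c) = (a • f + b • h) + fun _ => c := rfl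
  have h5 : ContDiffAt ℝ 2 (a • f + b • h) x := h1.add h2
  rw [h4, h5.laplacian_add h3, h1.laplacian_add h2,
    InnerProductSpace.laplacian_smul _ hf, InnerProductSpace.laplacian_smul _ hh]
  simp

theorem divergence_congr {n : ℕ}
    {F G : EuclideanSpace ℝ (Fin n) → EuclideanSpace ℝ (Fin n)} {x : EuclideanSpace ℝ (Fin n)}
    (h : F =ᶠ[𝓝 x] G) : divergence F x = divergence G x := by
  simp only [divergence, h.fderiv_eq]

/-- The flux is `α⁻¹p∇p = ∇(p²/(2α))`, so the operator is linear in `p²`. -/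
theorem gasOperator_darcy {n : ℕ} {U : Set (EuclideanSpace ℝ (Fin n))} (hU : IsOpen U) {α : ℝ}
    (hα : 0 < α) {f : EuclideanSpace ℝ (Fin n) → ℝ} {x : EuclideanSpace ℝ (Fin n)} (hx : x ∈ U)
    (hf : ContDiffOn ℝ 2 f U) :
    gasOperator α 0 U f x = (2 * α)⁻¹ * Laplacian.laplacian (fun y => f y ^ 2) x := by
  have hfx : ContDiffAt ℝ 2 (fun y => f y ^ 2) x := (hf.contDiffAt (hU.mem_nhds hx)).pow 2
  have heq : (fun y => (K₂ α 0 (f y * ‖grad U f y‖) * f y) • grad U f y) =ᶠ[𝓝 x]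
      gradient ((2 * α)⁻¹ • fun y => f y ^ 2) := by
    filter_upwards [hU.mem_nhds hx] with y hy
    have h1 : HasGradientWithinAt f (gradient f y) univ y :=
      hasGradientWithinAt_univ.2
        ((hf.contDiffAt (hU.mem_nhds hy)).differentiableAt (by norm_num)).hasGradientAt
    have h2 := h1.fun_sq.linear_comb h1.fun_sq (2 * α)⁻¹ 0 0
    have h3 : ((2 * α)⁻¹ • fun y => f y ^ 2) =
        fun y => (2 * α)⁻¹ * f y ^ 2 + 0 * f y ^ 2 + 0 := by
      ext z
      simp
    rw [h3, (hasGradientWithinAt_univ.1 h2).gradient, K₂_zero hα, grad_eq_gradient hU f hy,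
      zero_smul, add_zero, smul_smul]
    congr 1
    field_simp
  have hfx' : ContDiffAt ℝ 2 ((2 * α)⁻¹ • fun y => f y ^ 2) x := hfx.const_smul (2 * α)⁻¹
  rw [gasOperator, divergence_congr heq, divergence_gradient hfx',
    InnerProductSpace.laplacian_smul _ hfx, smul_eq_mul]

/-! ### The basic profile: its Laplacian and its sign. -/

namespace IsBasicProfile

variable {n : ℕ} {α A : ℝ} {U Γi Γe : Set (EuclideanSpace ℝ (Fin n))}
  {W : EuclideanSpace ℝ (Fin n) → ℝ}

theorem continuousOn (hW : IsBasicProfile α 0 A U Γi Γe W) : ContinuousOn W (closure U) :=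
  hW.differentiableOn.continuousOn

theorem contDiffAt (hU : IsReservoir U Γi Γe) (hW : IsBasicProfile α 0 A U Γi Γe W)
    {x : EuclideanSpace ℝ (Fin n)} (hx : x ∈ U) : ContDiffAt ℝ 2 W x :=
  hW.contDiffOn.contDiffAt (hU.isOpen.mem_nhds hx)

theorem laplacian_eq (hU : IsReservoir U Γi Γe) (hW : IsBasicProfile α 0 A U Γi Γe W)
    (hα : 0 < α) {x : EuclideanSpace ℝ (Fin n)} (hx : x ∈ U) :
    Laplacian.laplacian W x = -(α * A) := by
  have hWx := hW.contDiffAt hU hx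
  have heq : (fun y => K₂ α 0 ‖grad U W y‖ • grad U W y) =ᶠ[𝓝 x] gradient (α⁻¹ • W) := by
    filter_upwards [hU.isOpen.mem_nhds hx] with y hy
    have h1 : HasGradientWithinAt W (gradient W y) univ y :=
      hasGradientWithinAt_univ.2
        ((hW.contDiffAt hU hy).differentiableAt (by norm_num)).hasGradientAt
    have h2 := h1.linear_comb h1 α⁻¹ 0 0
    have h3 : (α⁻¹ • W) = fun y => α⁻¹ * W y + 0 * W y + 0 := by
      ext z
      simp
    rw [h3, (hasGradientWithinAt_univ.1 h2).gradient, K₂_zero hα, grad_eq_gradient hU.isOpen W hy,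
      zero_smul, add_zero]
  have h := hW.equation x hx
  have hWx' : ContDiffAt ℝ 2 (α⁻¹ • W) x := hWx.const_smul α⁻¹
  rw [divergence_congr heq, divergence_gradient hWx',
    InnerProductSpace.laplacian_smul _ hWx, smul_eq_mul] at h
  field_simp at h
  linarith

theorem nonneg (hU : IsReservoir U Γi Γe) (hW : IsBasicProfile α 0 A U Γi Γe W)
    (hα : 0 < α) (hA : 0 < A) : ∀ x ∈ closure U, 0 ≤ W x := by
  obtain ⟨M, hM⟩ := hU.isCompact_closure.exists_bound_of_continuousOn hW.continuousOn
  obtain ⟨x₀, hx₀⟩ := hU.nonempty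
  have hM0 : 0 ≤ M := (norm_nonneg _).trans (hM x₀ (subset_closure hx₀))
  have hgrad : ∀ t : ℝ, ∀ x ∈ closure U, HasGradientWithinAt
      (fun x => (-1) * W x + 0 * W x + -(M * (1 - t)))
      ((-1 : ℝ) • grad U W x + (0 : ℝ) • grad U W x) (closure U) x := fun t x hx =>
    (hasGradientWithinAt_grad (hW.differentiableOn x hx)).linear_comb
      (hasGradientWithinAt_grad (hW.differentiableOn x hx)) _ _ _
  have hderiv : ∀ t ∈ Icc (0 : ℝ) 1, ∀ x, HasDerivWithinAt
      (fun s : ℝ => (-1) * W x + 0 * W x + -(M * (1 - s))) M (Icc 0 1) t := fun t _ x => by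
    have := ((((hasDerivAt_id t).const_sub 1).const_mul M).neg).const_add ((-1) * W x + 0 * W x)
    simpa using this.hasDerivWithinAt
  -- The elliptic statement is made parabolic: `-W - M(1 - t)` starts nonpositive, and at `t = 1` it
  -- is `-W`. With diffusion `(M+1)/(αA)` its diffusion term equals `M + 1`, while its time
  -- derivative is `M`, a margin of `1`. The term `0 * W x` only fits the shape of
  -- `laplacian_linear_comb`.
  have key := parabolic_comparison hU (T := 1)
    (w := fun t x => (-1) * W x + 0 * W x + -(M * (1 - t))) (a₀ := (M + 1) / (α * A))
    (by
      have : ContinuousOn (fun z : ℝ × EuclideanSpace ℝ (Fin n) => W z.2)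
          (Icc 0 1 ×ˢ closure U) := hW.continuousOn.comp continuousOn_snd fun z hz => hz.2
      exact ((continuousOn_const.mul this).add (continuousOn_const.mul this)).add
        (Continuous.continuousOn (by fun_prop)))
    (fun x hx => by
      have := neg_le_of_abs_le (hM x hx)
      linarith)
    (fun t ht x hx => by
      simp only [hW.dirichlet x hx]
      nlinarith [ht.2])
    (fun t _ x hx => ⟨_, hgrad t x (hU.ext_subset_closure hx), by
      simp [inner_neg_left, hW.neumann x hx]⟩)
    (fun t ht x _ => (hderiv t ⟨ht.1.le, ht.2⟩ x).differentiableWithinAt)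
    (fun t _ x hx => by
      have := hW.contDiffAt hU hx
      fun_prop)
    (by positivity)
    (fun m _ => ⟨1, one_pos, fun t ht x hx _ => ⟨(M + 1) / (α * A), ⟨by positivity, le_rfl⟩, by
      have hWx := hW.contDiffAt hU hx
      have ht' : t ∈ Icc (0 : ℝ) 1 := ⟨ht.1.le, ht.2⟩
      rw [(hderiv t ht' x).derivWithin (uniqueDiffOn_Icc zero_lt_one t ht'),
        laplacian_linear_comb hWx hWx, hW.laplacian_eq hU hα hx]
      have : (M + 1) / (α * A) * (-1 * -(α * A) + 0 * -(α * A)) = M + 1 := by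
        field_simp
        ring
      linarith⟩⟩)
  intro x hx
  have := key 1 ⟨zero_le_one, le_rfl⟩ x hx
  linarith

end IsBasicProfile

/-! ### Comparison of a gas solution with the auxiliary pressure -/

namespace IsGasSolution

variable {n : ℕ} {α A B T : ℝ} {U Γi Γe : Set (EuclideanSpace ℝ (Fin n))}
  {W : EuclideanSpace ℝ (Fin n) → ℝ} {p : ℝ → EuclideanSpace ℝ (Fin n) → ℝ}

theorem contDiffAt {init : EuclideanSpace ℝ (Fin n) → ℝ} (hU : IsReservoir U Γi Γe)
    (hp : IsGasSolution α 0 A B T U Γi Γe init p) {t : ℝ} (ht : t ∈ Ioc 0 T)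
    {x : EuclideanSpace ℝ (Fin n)} (hx : x ∈ U) : ContDiffAt ℝ 2 (p t) x :=
  (hp.contDiffOn t ht).contDiffAt (hU.isOpen.mem_nhds hx)

theorem exists_bounds {init : EuclideanSpace ℝ (Fin n) → ℝ} (hU : IsReservoir U Γi Γe)
    (hp : IsGasSolution α 0 A B T U Γi Γe init p) :
    ∃ l > 0, ∃ P > 0, ∀ t ∈ Icc 0 T, ∀ x ∈ closure U, p t x ∈ Icc l P := by
  have hcpt : IsCompact (Icc 0 T ×ˢ closure U) := isCompact_Icc.prod hU.isCompact_closure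
  rcases (Icc 0 T ×ˢ closure U).eq_empty_or_nonempty with h0 | h0
  · refine ⟨1, one_pos, 1, one_pos, fun t ht x hx => ?_⟩
    exact absurd (mk_mem_prod ht hx) (h0 ▸ notMem_empty _)
  obtain ⟨⟨t₁, x₁⟩, hz₁, hmin⟩ := hcpt.exists_isMinOn h0 hp.continuousOn
  obtain ⟨⟨t₂, x₂⟩, hz₂, hmax⟩ := hcpt.exists_isMaxOn h0 hp.continuousOn
  exact ⟨_, hp.positive t₁ hz₁.1 x₁ hz₁.2, _, hp.positive t₂ hz₂.1 x₂ hz₂.2,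
    fun t ht x hx => ⟨hmin (mk_mem_prod ht hx), hmax (mk_mem_prod ht hx)⟩⟩

/-- For this combination `w`, the equations give `w_t - (p/α)Δw = A(bp + 2a(B - At))`, whose sign
`hstrict` controls. Initially `w = (2a + b)W`, so `hab` and `W ≥ 0` suffice there. -/
theorem comparison (hU : IsReservoir U Γi Γe) (hα : 0 < α) (hA : 0 < A)
    (hW : IsBasicProfile α 0 A U Γi Γe W)
    (hp : IsGasSolution α 0 A B T U Γi Γe (auxPressure A B W 0) p) {a b : ℝ}
    (hab : 2 * a + b ≤ 0)
    (hstrict : ∀ m > 0, ∃ c > 0, ∀ t ∈ Ioc 0 T, ∀ x ∈ U,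
      m ≤ a * p t x ^ 2 + b * W x + -(a * (B - A * t) ^ 2) →
        b * p t x + 2 * a * (B - A * t) ≤ -c) :
    ∀ t ∈ Icc 0 T, ∀ x ∈ closure U, a * p t x ^ 2 + b * W x + -(a * (B - A * t) ^ 2) ≤ 0 := by
  obtain ⟨l, hl, P, hP, hlP⟩ := hp.exists_bounds hU
  have hWnn := hW.nonneg hU hα hA
  have hderiv : ∀ t ∈ Ioc 0 T, ∀ x ∈ U, HasDerivWithinAt
      (fun s => a * p s x ^ 2 + b * W x + -(a * (B - A * s) ^ 2))
      (a * (2 * p t x * timeDeriv T p t x) + 2 * a * A * (B - A * t)) (Icc 0 T) t := by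
    intro t ht x hx
    have h1 := ((hp.time_differentiable t ht x hx).hasDerivWithinAt.pow 2).const_mul a
    have h2 : HasDerivWithinAt (fun s : ℝ => a * (B - A * s) ^ 2)
        (a * (2 * (B - A * t) * (-A))) (Icc 0 T) t := by
      have := ((((hasDerivAt_id t).const_mul A).const_sub B).pow 2).const_mul a
      simpa using this.hasDerivWithinAt
    have h3 := (h1.add_const (b * W x)).add h2.neg
    refine h3.congr_deriv ?_
    simp only [timeDeriv]
    ring
  refine parabolic_comparison hU (T := T) (a₀ := P / α)
    (w := fun t x => a * p t x ^ 2 + b * W x + -(a * (B - A * t) ^ 2)) ?_ ?_ ?_ ?_ ?_ ?_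
    (by positivity) ?_
  · have h1 : ContinuousOn (fun z : ℝ × EuclideanSpace ℝ (Fin n) => W z.2)
        (Icc 0 T ×ˢ closure U) := hW.continuousOn.comp continuousOn_snd fun z hz => hz.2
    exact ((continuousOn_const.mul (hp.continuousOn.pow 2)).add (continuousOn_const.mul h1)).add
      (Continuous.continuousOn (by fun_prop))
  · intro x hx
    have h1 := hWnn x hx
    rw [hp.initial x hx, auxPressure, Real.sq_sqrt (by positivity)]
    nlinarith
  · intro t ht x hx
    rw [hp.dirichlet t ht x hx, hW.dirichlet x hx]
    linarith
  · intro t ht x hx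
    have hxc := hU.ext_subset_closure hx
    refine ⟨_, (hasGradientWithinAt_grad (hp.differentiableOn t ht x hxc)).fun_sq.linear_comb
      (hasGradientWithinAt_grad (hW.differentiableOn x hxc)) a b _, ?_⟩
    have h1 := hp.neumann t ht x hx
    have h2 := hp.positive t ⟨ht.1.le, ht.2⟩ x hxc
    rw [velocity, K₂_zero hα, inner_smul_left, inner_neg_left, inner_smul_left] at h1
    have h3 : inner ℝ (grad U (p t) x) (outwardNormal U x) = 0 := by
      simpa [h2.ne', hα.ne'] using h1
    rw [inner_add_left, inner_smul_left, inner_smul_left, inner_smul_left, h3,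
      hW.neumann x hx]
    simp
  · exact fun t ht x hx => (hderiv t ht x hx).differentiableWithinAt
  · intro t ht x hx
    have h1 := hW.contDiffAt hU hx
    have h2 := hp.contDiffAt hU ht hx
    fun_prop
  · intro m hm
    obtain ⟨c, hc, h⟩ := hstrict m hm
    refine ⟨A * c, by positivity, fun t ht x hx hmw => ?_⟩
    have ht' : t ∈ Icc 0 T := ⟨ht.1.le, ht.2⟩
    have hpx := hlP t ht' x (subset_closure hx)
    have hp0 := hp.positive t ht' x (subset_closure hx)
    refine ⟨p t x / α, ⟨by positivity, by gcongr; exact hpx.2⟩, ?_⟩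
    rw [(hderiv t ht x hx).derivWithin (uniqueDiffOn_Icc (ht.1.trans_le ht.2) t ht'),
      laplacian_linear_comb ((hp.contDiffAt hU ht hx).pow 2) (hW.contDiffAt hU hx),
      hW.laplacian_eq hU hα hx, hp.equation t ht x hx,
      gasOperator_darcy hU.isOpen hα hx (hp.contDiffOn t ht)]
    have h1 := mul_le_mul_of_nonneg_left (h t ht x hx hmw) hA.le
    set L := Laplacian.laplacian (fun y => p t y ^ 2) x
    have e1 : a * (2 * p t x * ((2 * α)⁻¹ * L)) = p t x / α * (a * L) := by field_simp
    have e2 : p t x / α * (a * L + b * -(α * A)) = p t x / α * (a * L) - A * (b * p t x) := by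
      field_simp
      ring
    rw [e1, e2]
    linarith

/-- The upper bound takes `(a, b) = (1, -2)`: where it fails by `m`, `p` exceeds `B - At` by at
least `m/(P + B)`. The lower bound takes `(-1, 2 - k)` and relies on the upper one, which gives `p -
(B - At) ≤ M/(B - AT)` when `p ≥ B - At`. -/
theorem sq_bounds (hU : IsReservoir U Γi Γe) (hα : 0 < α) (hA : 0 < A)
    (hBT : 0 < B - A * T) (hT : 0 < T) (hW : IsBasicProfile α 0 A U Γi Γe W) {M : ℝ}
    (hM : ∀ x ∈ closure U, W x ≤ M)
    (hp : IsGasSolution α 0 A B T U Γi Γe (auxPressure A B W 0) p) :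
    ∀ t ∈ Icc 0 T, ∀ x ∈ closure U,
      (2 - (2 * M + 1) / (B - A * T) ^ 2) * W x ≤ p t x ^ 2 - (B - A * t) ^ 2 ∧
        p t x ^ 2 - (B - A * t) ^ 2 ≤ 2 * W x := by
  have hWnn := hW.nonneg hU hα hA
  obtain ⟨l, hl, P, hP, hlP⟩ := hp.exists_bounds hU
  obtain ⟨x₀, hx₀⟩ := hU.nonempty
  have hM0 : 0 ≤ M := (hWnn x₀ (subset_closure hx₀)).trans (hM x₀ (subset_closure hx₀))
  have hAT : 0 < A * T := mul_pos hA hT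
  have hB : 0 < B := by linarith
  have hb : ∀ t ∈ Icc 0 T, B - A * T ≤ B - A * t ∧ B - A * t ≤ B := fun t ht => by
    have h1 := mul_le_mul_of_nonneg_left ht.2 hA.le
    have h2 := mul_nonneg hA.le ht.1
    constructor <;> linarith
  have hupper : ∀ t ∈ Icc 0 T, ∀ x ∈ closure U,
      p t x ^ 2 - (B - A * t) ^ 2 ≤ 2 * W x := by
    have := comparison (a := 1) (b := -2) hU hα hA hW hp (by norm_num) (by
      intro m hm
      refine ⟨2 * (m / (P + B)), by positivity, fun t ht x hx hmw => ?_⟩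
      have ht' : t ∈ Icc 0 T := ⟨ht.1.le, ht.2⟩
      have hpx := hlP t ht' x (subset_closure hx)
      have hbt := hb t ht'
      have hWx := hWnn x (subset_closure hx)
      have h1 : m / (P + B) ≤ p t x - (B - A * t) := by
        rw [div_le_iff₀ (by positivity)]
        have h2 : 0 < p t x + (B - A * t) := by linarith [hpx.1]
        have h3 : m ≤ (p t x - (B - A * t)) * (p t x + (B - A * t)) := by linarith
        have h4 : 0 < p t x - (B - A * t) := by
          by_contra hneg
          have := mul_nonpos_of_nonpos_of_nonneg (not_lt.1 hneg) h2.le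
          linarith
        refine h3.trans (mul_le_mul_of_nonneg_left ?_ h4.le)
        linarith [hpx.2]
      linarith)
    intro t ht x hx
    have := this t ht x hx
    linarith
  set b₀ := B - A * T with hb₀
  set k := (2 * M + 1) / b₀ ^ 2 with hk
  have hk0 : 0 < k := by positivity
  have hlower := comparison (a := -1) (b := 2 - k) hU hα hA hW hp (by linarith) (by
    intro m hm
    -- The quantity to bound is `2(p - (B - At)) - kp`. If `p ≥ B - At` it is at most `2M/b₀ - kb₀ =
    -- -1/b₀`, which dictates the choice of `k`; otherwise it is at most `-kl`.
    refine ⟨min (1 / b₀) (k * l), by positivity, fun t ht x hx _ => ?_⟩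
    have ht' : t ∈ Icc 0 T := ⟨ht.1.le, ht.2⟩
    have hxc := subset_closure hx
    have hpx := hlP t ht' x hxc
    have hbt := hb t ht'
    have hup := hupper t ht' x hxc
    have hWM := hM x hxc
    rcases le_or_gt (B - A * t) (p t x) with hle | hlt
    · have h1 : p t x - (B - A * t) ≤ M / b₀ := by
        rw [le_div_iff₀ hBT]
        nlinarith
      have h2 : (2 * M + 1) / b₀ ≤ k * p t x := by
        have : (2 * M + 1) / b₀ = k * b₀ := by
          rw [hk]
          field_simp
        rw [this]
        exact mul_le_mul_of_nonneg_left (by linarith) hk0.le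
      have h3 : (2 * M + 1) / b₀ = 2 * (M / b₀) + 1 / b₀ := by ring
      have h4 := min_le_left (1 / b₀) (k * l)
      linarith
    · have h1 := mul_le_mul_of_nonneg_left hpx.1 hk0.le
      have h4 := min_le_right (1 / b₀) (k * l)
      linarith)
  intro t ht x hx
  have := hlower t ht x hx
  exact ⟨by linarith, hupper t ht x hx⟩

end IsGasSolution

/-! ### Fluxes through the well -/

namespace IsReservoir

variable {n : ℕ} {α A B : ℝ} {U Γi Γe : Set (EuclideanSpace ℝ (Fin n))}
  {f h W : EuclideanSpace ℝ (Fin n) → ℝ}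

/-- If `f ≤ h` with equality at a boundary point, then `∂h/∂N ≤ ∂f/∂N` there. -/
theorem normal_deriv_le (hU : IsReservoir U Γi Γe) {x f' h' : EuclideanSpace ℝ (Fin n)}
    (hx : x ∈ frontier U) (hf : HasGradientWithinAt f f' (closure U) x)
    (hh : HasGradientWithinAt h h' (closure U) x) (hle : ∀ y ∈ closure U, f y ≤ h y)
    (heq : f x = h x) :
    inner ℝ h' (outwardNormal U x) ≤ inner ℝ f' (outwardNormal U x) := by
  have h1 := (hU.boundary_C2.hasDerivWithinAt_normal hx hh).sub
    (hU.boundary_C2.hasDerivWithinAt_normal hx hf)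
  obtain ⟨s₀, hs₀, hs⟩ := hU.boundary_C2.exists_sub_smul_mem hx
  have h2 := h1.nonneg_of_eventually_ge (by
    filter_upwards [Ioo_mem_nhdsGT hs₀] with s hs'
    have := hle _ (subset_closure (hs s ⟨hs'.1, hs'.2.le⟩))
    simp only [Pi.sub_apply, zero_smul, sub_zero, heq, sub_self]
    linarith)
  linarith

/-- All members of the sandwich agree at a point of `Γi`, so it passes to normal derivatives with
reversed order; `∇(f²) = 2f∇f` turns these into fluxes. -/
theorem normal_flux_bounds (hU : IsReservoir U Γi Γe) (hW : IsBasicProfile α 0 A U Γi Γe W)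
    {c θ : ℝ} {x : EuclideanSpace ℝ (Fin n)} (hx : x ∈ Γi)
    (hf : DifferentiableWithinAt ℝ f (closure U) x) (hfx : f x ^ 2 = c)
    (hle : ∀ y ∈ closure U, θ * (2 * W y) ≤ f y ^ 2 - c ∧ f y ^ 2 - c ≤ 2 * W y) :
    inner ℝ (grad U W x) (outwardNormal U x)
        ≤ f x * inner ℝ (grad U f x) (outwardNormal U x) ∧
      f x * inner ℝ (grad U f x) (outwardNormal U x)
        ≤ θ * inner ℝ (grad U W x) (outwardNormal U x) := by
  have hxf := hU.well_subset_frontier hx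
  have hf2 := (hasGradientWithinAt_grad hf).fun_sq
  have hWg := hasGradientWithinAt_grad (hW.differentiableOn x (hU.well_subset_closure hx))
  have hW0 := hW.dirichlet x hx
  have h1 := hU.normal_deriv_le hxf hf2 (hWg.linear_comb hWg 2 0 c)
    (fun y hy => by linarith [(hle y hy).2]) (by rw [hfx, hW0]; ring)
  have h2 := hU.normal_deriv_le hxf (hWg.linear_comb hWg (θ * 2) 0 c) hf2
    (fun y hy => by linarith [(hle y hy).1]) (by rw [hfx, hW0]; ring)
  simp only [inner_add_left, real_inner_smul_left, zero_mul, add_zero] at h1 h2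
  constructor <;> linarith

theorem _root_.inner_velocity_darcy (hα : 0 < α) (x : EuclideanSpace ℝ (Fin n)) :
    inner ℝ (f x • velocity α 0 U f x) (outwardNormal U x) =
      -α⁻¹ * (f x * inner ℝ (grad U f x) (outwardNormal U x)) := by
  rw [velocity, K₂_zero hα, real_inner_smul_left, inner_neg_left, real_inner_smul_left]
  ring

theorem _root_.inner_auxFlux_darcy (hα : 0 < α) (x : EuclideanSpace ℝ (Fin n)) :
    inner ℝ (-(K₂ α 0 ‖grad U W x‖ • grad U W x)) (outwardNormal U x) =
      -α⁻¹ * inner ℝ (grad U W x) (outwardNormal U x) := by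
  rw [K₂_zero hα, inner_neg_left, real_inner_smul_left]
  ring

theorem continuousOn_normal_deriv (hU : IsReservoir U Γi Γe)
    (hf : ContinuousOn (grad U f) (closure U)) :
    ContinuousOn (fun x => inner ℝ (grad U f x) (outwardNormal U x)) Γi :=
  (hf.mono hU.well_subset_closure).inner
    ((hU.boundary_C2.continuousOn_outwardNormal hU.isOpen).mono hU.well_subset_frontier)

theorem integrableOn_well (hU : IsReservoir U Γi Γe) (hf : ContinuousOn f Γi) :
    IntegrableOn f Γi (surfaceMeasure n) := by
  have hfin : IsFiniteMeasure ((surfaceMeasure n).restrict Γi) :=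
    ⟨by simpa using hU.surfaceMeasure_well_lt_top⟩
  obtain ⟨M, hM⟩ := hU.isCompact_well.exists_bound_of_continuousOn hf
  exact Integrable.of_bound (hf.aestronglyMeasurable hU.closed_well.measurableSet) M
    ((ae_restrict_iff' hU.closed_well.measurableSet).2 (ae_of_all _ hM))

theorem integrableOn_domain (hU : IsReservoir U Γi Γe) (hf : ContinuousOn f (closure U)) :
    IntegrableOn f U :=
  (hf.integrableOn_compact hU.isCompact_closure).mono_set subset_closure

theorem massFlow_bounds (hU : IsReservoir U Γi Γe) (hα : 0 < α)
    (hW : IsBasicProfile α 0 A U Γi Γe W) {c θ : ℝ}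
    (hf : ∀ x ∈ Γi, DifferentiableWithinAt ℝ f (closure U) x)
    (hfc : ContinuousOn (grad U f) (closure U)) (hfx : ∀ x ∈ Γi, f x ^ 2 = c)
    (hle : ∀ y ∈ closure U, θ * (2 * W y) ≤ f y ^ 2 - c ∧ f y ^ 2 - c ≤ 2 * W y) {Q : ℝ}
    (hQ : Q = ∫ x in Γi, inner ℝ (-(K₂ α 0 ‖grad U W x‖ • grad U W x)) (outwardNormal U x)
      ∂(surfaceMeasure n)) :
    θ * Q ≤ massFlow α 0 U Γi f ∧ massFlow α 0 U Γi f ≤ Q := by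
  have hα' : 0 < α⁻¹ := inv_pos.2 hα
  have hi1 : IntegrableOn (fun x => -α⁻¹ * inner ℝ (grad U W x) (outwardNormal U x)) Γi
      (surfaceMeasure n) :=
    hU.integrableOn_well (continuousOn_const.mul (hU.continuousOn_normal_deriv hW.continuousOn_grad))
  have hfcont : ContinuousOn f Γi := fun x hx =>
    (hf x hx).continuousWithinAt.mono hU.well_subset_closure
  have hi2 : IntegrableOn (fun x => -α⁻¹ * (f x * inner ℝ (grad U f x) (outwardNormal U x))) Γi
      (surfaceMeasure n) :=
    hU.integrableOn_well
      (continuousOn_const.mul (hfcont.mul (hU.continuousOn_normal_deriv hfc)))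
  simp only [massFlow, inner_velocity_darcy hα]
  simp only [inner_auxFlux_darcy hα] at hQ
  rw [hQ, ← integral_const_mul]
  constructor
  · refine setIntegral_mono_on (hi1.const_mul θ) hi2 hU.closed_well.measurableSet fun x hx => ?_
    have := (hU.normal_flux_bounds hW hx (hf x hx) (hfx x hx) hle).2
    nlinarith
  · refine setIntegral_mono_on hi2 hi1 hU.closed_well.measurableSet fun x hx => ?_
    have := (hU.normal_flux_bounds hW hx (hf x hx) (hfx x hx) hle).1
    nlinarith

theorem auxFlux_nonneg (hU : IsReservoir U Γi Γe) (hα : 0 < α) (hA : 0 < A)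
    (hW : IsBasicProfile α 0 A U Γi Γe W) :
    0 ≤ ∫ x in Γi, inner ℝ (-(K₂ α 0 ‖grad U W x‖ • grad U W x)) (outwardNormal U x)
      ∂(surfaceMeasure n) := by
  refine setIntegral_nonneg hU.closed_well.measurableSet fun x hx => ?_
  have hWg := hasGradientWithinAt_grad (hW.differentiableOn x (hU.well_subset_closure hx))
  have h1 := hU.normal_deriv_le (hU.well_subset_frontier hx)
    (hasGradientWithinAt_const (s := closure U) x (0 : ℝ)) hWg (hW.nonneg hU hα hA)
    (hW.dirichlet x hx).symm
  rw [inner_zero_left] at h1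
  rw [inner_auxFlux_darcy hα]
  exact mul_nonneg_of_nonpos_of_nonpos (neg_nonpos.2 (inv_nonneg.2 hα.le)) h1

theorem average_well (hU : IsReservoir U Γi Γe) {c : ℝ} (hfx : ∀ x ∈ Γi, f x ^ 2 = c) :
    ⨍ x in Γi, f x ^ 2 ∂(surfaceMeasure n) = c := by
  rw [setAverage_congr_fun hU.closed_well.measurableSet (ae_of_all _ hfx)]
  exact setAverage_const hU.surfaceMeasure_well_pos.ne' hU.surfaceMeasure_well_lt_top.ne c

theorem drawdown_bounds (hU : IsReservoir U Γi Γe) (hW : ContinuousOn W (closure U))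
    {c θ : ℝ} (hf : ContinuousOn f (closure U)) (hfx : ∀ x ∈ Γi, f x ^ 2 = c)
    (hle : ∀ y ∈ closure U, θ * (2 * W y) ≤ f y ^ 2 - c ∧ f y ^ 2 - c ≤ 2 * W y) :
    θ * (⨍ x in U, 2 * W x) ≤ drawdown U Γi f ∧ drawdown U Γi f ≤ ⨍ x in U, 2 * W x := by
  have hvol : 0 < volume.real U := ENNReal.toReal_pos hU.volume_ne_zero hU.volume_ne_top
  have hic : IntegrableOn (fun _ : EuclideanSpace ℝ (Fin n) => c) U :=
    integrableOn_const hU.volume_ne_top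
  have hi1 : IntegrableOn (fun x => f x ^ 2) U := hU.integrableOn_domain (hf.pow 2)
  have hi2 : IntegrableOn (fun x => 2 * W x) U :=
    hU.integrableOn_domain (continuousOn_const.mul hW)
  have hd : drawdown U Γi f = (volume.real U)⁻¹ * ∫ x in U, (f x ^ 2 - c) := by
    rw [drawdown, hU.average_well hfx, setAverage_eq, integral_sub hi1 hic, setIntegral_const,
      smul_eq_mul, smul_eq_mul, mul_sub, inv_mul_cancel_left₀ hvol.ne']
  rw [hd, setAverage_eq, smul_eq_mul, mul_left_comm, ← integral_const_mul]
  constructor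
  · refine mul_le_mul_of_nonneg_left ?_ (inv_nonneg.2 hvol.le)
    exact setIntegral_mono_on (hi2.const_mul θ) (hi1.sub hic) hU.isOpen.measurableSet
      fun x hx => (hle x (subset_closure hx)).1
  · refine mul_le_mul_of_nonneg_left ?_ (inv_nonneg.2 hvol.le)
    exact setIntegral_mono_on (hi1.sub hic) hi2 hU.isOpen.measurableSet
      fun x hx => (hle x (subset_closure hx)).2

/-- The sandwich holds with `θ = 1`, so the drawdown bounds and the pointwise flux bounds collapse
to equalities. -/
theorem productivityIndex_auxPressure (hU : IsReservoir U Γi Γe) (hα : 0 < α) (hA : 0 < A)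
    (hW : IsBasicProfile α 0 A U Γi Γe W) {t : ℝ} (ht : 0 < B - A * t) :
    productivityIndex α 0 U Γi (auxPressure A B W t) = auxIndex α 0 U Γi W := by
  have hWnn := hW.nonneg hU hα hA
  have hpos : ∀ x ∈ closure U, 0 < (B - A * t) ^ 2 + 2 * W x := fun x hx => by
    have := hWnn x hx
    positivity
  have hsq : ∀ x ∈ closure U, auxPressure A B W t x ^ 2 = (B - A * t) ^ 2 + 2 * W x :=
    fun x hx => Real.sq_sqrt (hpos x hx).le
  have hsqi : ∀ x ∈ Γi, auxPressure A B W t x ^ 2 = (B - A * t) ^ 2 := fun x hx => by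
    rw [hsq x (hU.well_subset_closure hx), hW.dirichlet x hx, mul_zero, add_zero]
  have hle : ∀ y ∈ closure U,
      1 * (2 * W y) ≤ auxPressure A B W t y ^ 2 - (B - A * t) ^ 2 ∧
        auxPressure A B W t y ^ 2 - (B - A * t) ^ 2 ≤ 2 * W y := fun y hy => by
    rw [hsq y hy]
    constructor <;> linarith
  have hdiff : ∀ x ∈ closure U,
      DifferentiableWithinAt ℝ (auxPressure A B W t) (closure U) x := fun x hx =>
    (((hW.differentiableOn x hx).const_mul 2).const_add _).sqrt (hpos x hx).ne'
  have hd := hU.drawdown_bounds hW.continuousOn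
    (fun x hx => (hdiff x hx).continuousWithinAt) hsqi hle
  rw [one_mul] at hd
  rw [productivityIndex, auxIndex, le_antisymm hd.2 hd.1]
  congr 1
  refine setIntegral_congr_fun hU.closed_well.measurableSet fun x hx => ?_
  have h1 := hU.normal_flux_bounds hW hx (hdiff x (hU.well_subset_closure hx)) (hsqi x hx) hle
  rw [one_mul] at h1
  simp only [inner_velocity_darcy hα, inner_auxFlux_darcy hα, le_antisymm h1.2 h1.1]

/-- Needed at `t = 0`, where a solution is known only by its values on the closure; the one-sided
gradient depends on nothing else. -/
theorem productivityIndex_congr (hU : IsReservoir U Γi Γe) {β : ℝ} (h_eq : EqOn f h (closure U)) :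
    productivityIndex α β U Γi f = productivityIndex α β U Γi h := by
  have h1 : massFlow α β U Γi f = massFlow α β U Γi h := by
    refine setIntegral_congr_fun hU.closed_well.measurableSet fun x hx => ?_
    have hxc := hU.well_subset_closure hx
    simp only [velocity, h_eq hxc, grad_congr h_eq hxc]
  have h2 : ⨍ x in U, f x ^ 2 = ⨍ x in U, h x ^ 2 :=
    setAverage_congr_fun hU.isOpen.measurableSet
      (ae_of_all _ fun x hx => by rw [h_eq (subset_closure hx)])
  have h3 : ⨍ x in Γi, f x ^ 2 ∂(surfaceMeasure n) = ⨍ x in Γi, h x ^ 2 ∂(surfaceMeasure n) :=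
    setAverage_congr_fun hU.closed_well.measurableSet
      (ae_of_all _ fun x hx => by rw [h_eq (hU.well_subset_closure hx)])
  rw [productivityIndex, productivityIndex, drawdown, drawdown, h1, h2, h3]

end IsReservoir

/-! ### The quantitative estimate and the limit. -/

theorem abs_div_sub_div_le {X Z Q Y θ : ℝ} (hθ : 1 / 2 ≤ θ) (hQ : 0 ≤ Q)
    (hY : 0 ≤ Y) (hX : θ * Q ≤ X ∧ X ≤ Q) (hZ : θ * Y ≤ Z ∧ Z ≤ Y) :
    |X / Z - Q / Y| ≤ Q / Y * (2 * (1 - θ)) := by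
  -- If `Y = 0` then `Z = 0`, and both quotients are `0` by the convention for division by zero;
  -- positivity of the mean of `W` is thus never required.
  rcases hY.eq_or_lt with h0 | h0
  · have : Z = 0 := by
      rw [← h0, mul_zero] at hZ
      exact le_antisymm hZ.2 hZ.1
    simp [← h0, this]
  have hθ1 : θ ≤ 1 := by
    by_contra hlt
    nlinarith [hZ.1, hZ.2]
  have hθY : 0 < θ * Y := by positivity
  have hZpos : 0 < Z := hθY.trans_le hZ.1
  have hup : X / Z ≤ Q / Y * θ⁻¹ := by
    calc X / Z ≤ Q / (θ * Y) := div_le_div₀ hQ hX.2 hθY hZ.1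
      _ = Q / Y * θ⁻¹ := by field_simp
  have hlo : Q / Y * θ ≤ X / Z := by
    calc Q / Y * θ = θ * Q / Y := by ring
      _ ≤ X / Z := div_le_div₀ ((by positivity : 0 ≤ θ * Q).trans hX.1) hX.1 hZpos hZ.2
  have hJ : 0 ≤ Q / Y := by positivity
  -- Equivalent to `(2θ - 1)(1 - θ) ≥ 0`, hence the restriction to `θ ≥ 1/2`.
  have hinv : θ⁻¹ ≤ 1 + 2 * (1 - θ) := by
    rw [inv_le_iff_one_le_mul₀ (by linarith)]
    nlinarith
  have h1 := mul_le_mul_of_nonneg_left hinv hJ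
  have h2 : 0 ≤ Q / Y * (1 - θ) := mul_nonneg hJ (by linarith)
  rw [abs_le]
  constructor <;> linarith

theorem IsGasSolution.abs_productivityIndex_sub_le {n : ℕ} {α A B T M : ℝ}
    {U Γi Γe : Set (EuclideanSpace ℝ (Fin n))} {W : EuclideanSpace ℝ (Fin n) → ℝ}
    {p : ℝ → EuclideanSpace ℝ (Fin n) → ℝ} (hU : IsReservoir U Γi Γe) (hα : 0 < α) (hA : 0 < A)
    (hBT : 0 < B - A * T) (hW : IsBasicProfile α 0 A U Γi Γe W)
    (hM : ∀ x ∈ closure U, W x ≤ M)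
    (hp : IsGasSolution α 0 A B T U Γi Γe (auxPressure A B W 0) p)
    (hk : (2 * M + 1) / (B - A * T) ^ 2 ≤ 1) {t : ℝ} (ht : t ∈ Ioc 0 T) :
    |productivityIndex α 0 U Γi (p t) - auxIndex α 0 U Γi W| ≤
      auxIndex α 0 U Γi W * ((2 * M + 1) / (B - A * T) ^ 2) := by
  have ht' : t ∈ Icc 0 T := ⟨ht.1.le, ht.2⟩
  have hWnn := hW.nonneg hU hα hA
  set k := (2 * M + 1) / (B - A * T) ^ 2
  have hle : ∀ y ∈ closure U, (1 - k / 2) * (2 * W y) ≤ p t y ^ 2 - (B - A * t) ^ 2 ∧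
      p t y ^ 2 - (B - A * t) ^ 2 ≤ 2 * W y := fun y hy => by
    have := hp.sq_bounds hU hα hA hBT (ht.1.trans_le ht.2) hW hM t ht' y hy
    exact ⟨by linarith [this.1], this.2⟩
  have hfx : ∀ x ∈ Γi, p t x ^ 2 = (B - A * t) ^ 2 := fun x hx => by
    rw [hp.dirichlet t ht' x hx]
  have hgc : ContinuousOn (grad U (p t)) (closure U) :=
    hp.continuousOn_grad.comp (Continuous.prodMk_right t).continuousOn fun x hx => ⟨ht, hx⟩
  have hX := hU.massFlow_bounds hα hW
    (fun x hx => hp.differentiableOn t ht x (hU.well_subset_closure hx)) hgc hfx hle rfl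
  have hZ := hU.drawdown_bounds hW.continuousOn (hp.differentiableOn t ht).continuousOn hfx hle
  have hY : 0 ≤ ⨍ x in U, 2 * W x := by
    rw [setAverage_eq, smul_eq_mul]
    refine mul_nonneg (inv_nonneg.2 measureReal_nonneg)
      (setIntegral_nonneg hU.isOpen.measurableSet fun x hx => ?_)
    exact mul_nonneg zero_le_two (hWnn x (subset_closure hx))
  have := abs_div_sub_div_le (by linarith) (hU.auxFlux_nonneg hα hA hW) hY hX hZ
  rw [show 2 * (1 - (1 - k / 2)) = k by ring] at this
  exact this

theorem mainTheorem3 {n : ℕ} (hn : 2 ≤ n) (U Γi Γe : Set (EuclideanSpace ℝ (Fin n)))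
    (hU : IsReservoir U Γi Γe) (α A T₀ : ℝ) (hα : 0 < α) (hA : 0 < A) (hT₀ : 0 < T₀)
    (W : EuclideanSpace ℝ (Fin n) → ℝ) (hW : IsBasicProfile α 0 A U Γi Γe W) :
    (∀ B : ℝ, T₀ < criticalTime A B → ∀ t ∈ Icc 0 T₀,
      productivityIndex α 0 U Γi (auxPressure A B W t) = auxIndex α 0 U Γi W) ∧
    ∀ C : ℝ, ∀ ε > 0, ∃ B₀ : ℝ, ∀ B ≥ B₀, T₀ < criticalTime A B →
      ∀ p : ℝ → EuclideanSpace ℝ (Fin n) → ℝ,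
        IsGasSolution α 0 A B T₀ U Γi Γe (auxPressure A B W 0) p →
        DerivativeBounds T₀ C U p →
        ∀ t ∈ Icc 0 T₀,
          |productivityIndex α 0 U Γi (p t) - auxIndex α 0 U Γi W| < ε := by
  have hcrit : ∀ B : ℝ, T₀ < criticalTime A B → 0 < B - A * T₀ := fun B hB => by
    rw [criticalTime, lt_div_iff₀ hA] at hB
    linarith
  have hpartA : ∀ B : ℝ, T₀ < criticalTime A B → ∀ t ∈ Icc 0 T₀,
      productivityIndex α 0 U Γi (auxPressure A B W t) = auxIndex α 0 U Γi W := fun B hB t ht => by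
    have h1 := hcrit B hB
    have h2 := mul_le_mul_of_nonneg_left ht.2 hA.le
    exact hU.productivityIndex_auxPressure hα hA hW (by linarith)
  refine ⟨hpartA, fun C ε hε => ?_⟩
  obtain ⟨M, hM⟩ := hU.isCompact_closure.exists_bound_of_continuousOn hW.continuousOn
  -- The bound involves `B - At` only at its smallest value, at `t = T₀`, so `B₀` serves all times
  -- at once.
  have hlim : Tendsto (fun B : ℝ => (2 * M + 1) / (B - A * T₀) ^ 2) atTop (𝓝 0) :=
    ((tendsto_pow_atTop two_ne_zero).comp (tendsto_atTop_add_const_right atTop (-(A * T₀))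
      tendsto_id)).const_div_atTop (2 * M + 1)
  have hlim' := hlim.const_mul (auxIndex α 0 U Γi W)
  rw [mul_zero] at hlim'
  obtain ⟨B₀, hB₀⟩ := eventually_atTop.1
    ((hlim.eventually_le_const one_pos).and (hlim'.eventually_lt_const hε))
  refine ⟨B₀, fun B hB hBT p hp _ t ht => ?_⟩
  rcases ht.1.eq_or_lt with h0 | h0
  · subst h0
    rw [hU.productivityIndex_congr (h := auxPressure A B W 0) hp.initial,
      hpartA B hBT 0 ht, sub_self, abs_zero]
    exact hε
  · obtain ⟨hk, hJk⟩ := hB₀ B hB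
    exact (hp.abs_productivityIndex_sub_le hU hα hA (hcrit B hBT) hW
      (fun x hx => (le_abs_self _).trans (hM x hx)) hk ⟨h0, ht.2⟩).trans_lt hJk
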